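/- **Model.** Fix an integer $c\ge 1$. An input network is a finite simple undirected graph (not necessarily connected) with $n$ nodes, where every node knows $n$, has a unique identifier in $\{1,\dots,n^c\}$, an input label, a numbering (by ports) of its incident half-edges, and an input label on each of these half-edges. An outcome $\mathrm O$ maps every input network to a probability distribution over output labelings. For a set $A$ of nodes, the radius-$T$ view of $A$ consists of the nodes at distance at most $T$ from $A$ with all their inputs, and of the edges between them that have an endpoint at distance less than $T$ from $A$ (with their port numbers). Given $T:\mathbb N\to\mathbb N$, $\mathrm O$ is non-signaling beyond distance $T(n)$ (has locality $T$) on a family of inputs if, for all $n$-node inputs $G,H$ of the family, all node sets $A\subseteq V(G)$, $B\subseteq V(H)$ and every $\varphi:V(G)\to V(H)$ that is an isomorphism between the radius-$0$ views and between the radius-$T(n)$ views of $A$ and $B$, the restrictions of $\mathrm O(G)$ to $A$ and of $\mathrm O(H)$ to $B$ are isomorphic under $\varphi$. $\mathrm O$ solves a problem with failure probability $p(n)$ if on every $n$-node input of the problem its output is invalid with probability at most $p(n)$. **Linearizable problems.** A linearizable problem $\Pi^{\mathsf{linearizable}}=(\Sigma,(F,L,P),B)$ consists of a finite label set $\Sigma$,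 sets $F,L\subseteq\Sigma$ and $P\subseteq\Sigma\times\Sigma$, a finite list $B$ of multisets over $\Sigma$, and a finite set $D\subset\mathbb N$ of admissible hyperedge sizes ($D=\{1,\dots,r\}$ for hypergraphs of rank at most $r$, $D=\{2\}$ for graphs). Its inputs are the bipartite incidence graphs of hypergraphs, with colors given: white nodes are the nodes and black nodes the hyperedges of the hypergraph, and black degrees lie in $D$. Every edge gets a label from $\Sigma$ (output by its white endpoint) such that, at every white node, in port order, the first label is in $F$, the last is in $L$ and all pairs of consecutive labels are in $P$ (no condition for degree $0$), and, at every black node, the multiset of labels of the incident edges is in $B$. **Gadgets.** A tree-like gadget of height $\ell\ge 1$ is the complete binary tree with levels $0,\dots,\ell-1$ in which, in addition, consecutive nodes of every level are joined by an edge. An octopus gadget consists of a tree-like gadget (the head-gadget) in which every leaf is joined to the roots of one or two further tree-like gadgets (the port-gadgets, of arbitrary heights). A proper instance is a graph made of disjoint octopus gadgets and an independent set of inter-octopus nodes, where the left-most leaf of each port-gadget is joined to exactly one inter-octopus node and there are no other edges between octopus gadgets or between them and inter-octopus nodes. Let $\mathcal G$ be the family of proper instances labeled in the intended way: every node is labeled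 as head-gadget, port-gadget or inter-octopus node, and every half-edge is labeled with its direction (left, right, parent, left child, right child, first or second port-gadget, up to the head-gadget, outward, inward). Membership in $\mathcal G$ is expressed by local constraints at all nodes. **Lifted problems.** The problem $\Pi^{\mathsf{promise}}$, on the graphs of $\mathcal G$ whose inter-octopus nodes have degrees in $D$, asks every node outside the port-gadgets to output $\bot$ and every node of a port-gadget to output a label of $\Sigma$ that is the same throughout the port-gadget, so that in every octopus gadget, with its port-gadgets in left-to-right order, the first label is in $F$, the last is in $L$ and consecutive labels are in $P$, and so that at every inter-octopus node the multiset of labels of the incident port-gadgets is in $B$. The problem $\Pi^{\mathsf{badGraph}}$, on arbitrarily labeled graphs, asks every node to be unmarked or marked. A marked node either claims an error, which is allowed only if its local constraints fail, or outputs the label of one of its half-edges, as a pointer to a marked node. The target of a pointer must claim an error, or point with the same half-edge label inside the same kind of gadget, or point in a strictly later phase, where the phases are, in order: (1) port-gadget, parent; (2) port-gadget, up; (3) head-gadget, parent; (4) head-gadget, right child; (5) head-gadget, left or right; (6) head-gadget, first or second port-gadget; (7) port-gadget, right child; (8) port-gadget, left or right; (9) port-gadget, outward; no other pointers are allowed.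 The graph induced by the unmarked nodes must satisfy the local constraints of $\mathcal G$. The problem $\Pi=\mathrm{lift}(\Pi^{\mathsf{linearizable}})$, on arbitrarily labeled graphs of maximum degree at most $\max(5,\max D)$, asks to solve $\Pi^{\mathsf{badGraph}}$ and then $\Pi^{\mathsf{promise}}$ on the graph induced by the unmarked nodes, where inter-octopus nodes whose remaining degree is not in $D$ have no constraint. **Statement.** Let $\Pi^{\mathsf{linearizable}}$ be any linearizable problem. 1. There is a constant $C>0$ such that the following holds for every non-increasing $p:\mathbb N\to\mathbb R$ bounded above by a constant $q<1$ and every $T:\mathbb N\to\mathbb N$. If some outcome that is non-signaling beyond distance $T(n)$ solves $\Pi^{\mathsf{promise}}$, or solves $\Pi$, with failure probability at most $p(n)$, then for some $T'$ there is an outcome that is non-signaling beyond distance $T'(n)$ and solves $\Pi^{\mathsf{linearizable}}$ with failure probability at most $p(n)$, where $T'(n)\le C\,T(n^3)/\log n$ for all sufficiently large $n$. 2. There is a constant $\kappa>0$ such that the following holds for every such $p$ and every $T:\mathbb N\to\mathbb R$. Suppose that $T$ is a lower bound on the locality of $\Pi^{\mathsf{linearizable}}$: every non-signaling outcome that solves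 it with failure probability at most $p(n)$ has locality at least $T(n)$ for all sufficiently large $n$. Then every non-signaling outcome that solves $\Pi^{\mathsf{promise}}$, or that solves $\Pi$, with failure probability at most $p(n)$ has locality at least $\kappa\,T(\lfloor n^{1/3}\rfloor)\log n$ for all sufficiently large $n$. -/

import Mathlib

open Filter

/-! ### Networks -/

/-- An input network `(G, x)`: a finite simple graph (not necessarily connected) whose nodes carry
a unique identifier from `{1, …, n ^ c}`, an input label from `X`, and a port numbering
`0, …, deg v - 1` of their incident half-edges, each of which carries an input label from `Y`.
`halfLabels v` lists the labels of the half-edges of `v` by port number (so its length is the degree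
of `v`), and `port v u` is the port number of the half-edge `(v, {v, u})`. -/
structure Network (c : ℕ) (X Y : Type) where
  V : Type
  [fintypeV : Fintype V]
  graph : SimpleGraph V
  ident : V → ℕ
  ident_injective : Function.Injective ident
  ident_mem : ∀ v, ident v ∈ Set.Icc 1 (Fintype.card V ^ c)
  label : V → X
  halfLabels : V → List Y
  port : V → V → ℕ
  port_bijOn : ∀ v, Set.BijOn (port v) (graph.neighborSet v) (Set.Iio (halfLabels v).length)

attribute [instance] Network.fintypeV

namespace Network

variable {c : ℕ} {X Y : Type}

/-- The number `n` of nodes. -/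
def size (N : Network c X Y) : ℕ := Fintype.card N.V

noncomputable def degree (N : Network c X Y) (v : N.V) : ℕ := (N.graph.neighborSet v).ncard

/-- The nodes at distance at most `T` from the set `A`. -/
def ball (N : Network c X Y) (A : Set N.V) (T : ℕ) : Set N.V :=
  {v | ∃ a ∈ A, N.graph.edist a v ≤ (T : ℕ∞)}

/-- The nodes at distance strictly less than `T` from the set `A`. -/
def openBall (N : Network c X Y) (A : Set N.V) (T : ℕ) : Set N.V :=
  {v | ∃ a ∈ A, N.graph.edist a v < (T : ℕ∞)}

/-- The edges of the radius-`T` view of `A`: edges between nodes at distance at most `T` from `A`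
that have an endpoint at distance less than `T` from `A`. -/
def ViewAdj (N : Network c X Y) (A : Set N.V) (T : ℕ) (u w : N.V) : Prop :=
  N.graph.Adj u w ∧ u ∈ N.ball A T ∧ w ∈ N.ball A T ∧ (u ∈ N.openBall A T ∨ w ∈ N.openBall A T)

/-- `φ` is an isomorphism from the radius-`T` view of `A` in `G` to the radius-`T` view of `B`
in `H`. It preserves the visible nodes and edges, the port numbers of the visible edges, and the
whole input of every visible node: its identifier, its label and the labels of all its
half-edges (hence its degree). -/
structure ViewIso (G H : Network c X Y) (A : Set G.V) (B : Set H.V) (T : ℕ)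
    (φ : G.V → H.V) : Prop where
  bijOn : Set.BijOn φ (G.ball A T) (H.ball B T)
  adj_iff : ∀ u ∈ G.ball A T, ∀ w ∈ G.ball A T,
    (G.ViewAdj A T u w ↔ H.ViewAdj B T (φ u) (φ w))
  port_eq : ∀ u w, G.ViewAdj A T u w → G.port u w = H.port (φ u) (φ w)
  ident_eq : ∀ u ∈ G.ball A T, G.ident u = H.ident (φ u)
  label_eq : ∀ u ∈ G.ball A T, G.label u = H.label (φ u)
  halfLabels_eq : ∀ u ∈ G.ball A T, G.halfLabels u = H.halfLabels (φ u)

end Network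

/-! ### Problems and non-signaling outcomes -/

/-- A labeling problem on networks: the family of admissible inputs, and the valid outputs on
each of them. Every node outputs an element of `Z`. -/
structure DistProblem (c : ℕ) (X Y Z : Type) where
  inputs : Set (Network c X Y)
  Solution : (N : Network c X Y) → (N.V → Z) → Prop

/-- An outcome maps every input network to a probability distribution over output labelings. -/
def Outcome (c : ℕ) (X Y Z : Type) : Type 1 := (N : Network c X Y) → PMF (N.V → Z)

namespace DistProblem

variable {c : ℕ} {X Y Z : Type}

/-- The outcome `O` solves the problem with failure probability at most `p n` on `n`-node inputs. -/
def SolvedBy (Q : DistProblem c X Y Z) (O : Outcome c X Y Z) (p : ℕ → ℝ) : Prop :=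
  ∀ N ∈ Q.inputs, (O N).toOuterMeasure {y | ¬ Q.Solution N y} ≤ ENNReal.ofReal (p N.size)

/-- On the inputs of the problem, the outcome `O` is non-signaling beyond distance `T n`, where `n`
is the number of nodes, which is part of the input of every node: whenever the radius-`T n` views
(and the radius-`0` views) of `A` and `B` are isomorphic under `φ`, the restrictions of the two
output distributions to `A` and `B` are isomorphic under `φ`. -/
def NonSignaling (Q : DistProblem c X Y Z) (O : Outcome c X Y Z) (T : ℕ → ℕ) : Prop :=
  ∀ G ∈ Q.inputs, ∀ H ∈ Q.inputs, G.size = H.size →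
    ∀ (A : Set G.V) (B : Set H.V) (φ : G.V → H.V),
      Network.ViewIso G H A B 0 φ → Network.ViewIso G H A B (T G.size) φ →
        (O G).map (fun y (a : A) => y a.1) = (O H).map (fun y (a : A) => y (φ a.1))

/-- Some outcome of locality `T` solves the problem with failure probability at most `p`. -/
def SolvableNS (Q : DistProblem c X Y Z) (p : ℕ → ℝ) (T : ℕ → ℕ) : Prop :=
  ∃ O : Outcome c X Y Z, Q.NonSignaling O T ∧ Q.SolvedBy O p

end DistProblem

/-! ### Linearizable problems -/

/-- A linearizable problem with label set `S`. The finite set `sizes` specifies which hyperedge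
sizes (degrees of black nodes) occur in the input hypergraphs, for example `{1, …, r}` for
hypergraphs of rank at most `r`, or `{2}` for graphs. -/
structure LinearizableProblem (S : Type) where
  first : Finset S
  last : Finset S
  pairs : Finset (S × S)
  black : Finset (Multiset S)
  sizes : Finset ℕ

inductive Color
  | white
  | black

namespace LinearizableProblem

variable {S : Type}

/-- The linearizable problem as a problem on bipartite incidence graphs of hypergraphs. The edges of
the graph, that is, the half-edges of the hypergraph, are labeled by their white endpoints: a white
node outputs the list of the labels of its incident edges, in the order of its port numbers. -/
def problem (P : LinearizableProblem S) (c : ℕ) : DistProblem c Color Unit (List S) where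
  inputs := {N | (∀ u w, N.graph.Adj u w → N.label u ≠ N.label w) ∧
    ∀ u, N.label u = Color.black → N.degree u ∈ P.sizes}
  Solution N y :=
    (∀ v, N.label v = Color.white →
      (y v).length = N.degree v ∧
      (∀ s ∈ (y v).head?, s ∈ P.first) ∧
      (∀ s ∈ (y v).getLast?, s ∈ P.last) ∧
      (y v).IsChain (fun s t => (s, t) ∈ P.pairs)) ∧
    (∀ u, N.label u = Color.black →
      y u = [] ∧
      ∃ m ∈ P.black, (Set.toFinite (N.graph.neighborSet u)).toFinset.val.map
        (fun v => (y v)[N.port v u]?) = m.map some)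

end LinearizableProblem

/-! ### Labeled gadget graphs -/

/-- Node labels: nodes of head-gadgets, nodes of port-gadgets, inter-octopus nodes. -/
inductive NodeKind
  | head
  | port
  | inter

/-- Half-edge labels. The first five describe the edges inside a tree-like gadget; `portA` and
`portB` lead from a leaf of a head-gadget to the roots of its first and second port-gadget, `up`
leads back; `outward` leads from the left-most leaf of a port-gadget to an inter-octopus node, and
`inward` leads back. -/
inductive HalfKind
  | left
  | right
  | parent
  | childL
  | childR
  | portA
  | portB
  | up
  | outward
  | inward

/-- A graph whose nodes and half-edges are labeled: `step a u w` says that `{u, w}` is an edge and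
that its half-edge at `u` has label `a`. -/
structure GadgetGraph (V : Type) where
  kind : V → NodeKind
  step : HalfKind → V → V → Prop

/-- The labeled graph underlying a network. -/
def Network.gadgetGraph {c : ℕ} (N : Network c NodeKind HalfKind) : GadgetGraph N.V where
  kind := N.label
  step a u w := N.graph.Adj u w ∧ (N.halfLabels u)[N.port u w]? = some a

/-- `EdgeOK k a b l`: an edge may join a node of kind `k` to a node of kind `l` with half-edge
labels `a` and `b`, respectively. -/
inductive EdgeOK : NodeKind → HalfKind → HalfKind → NodeKind → Prop
  | left_right (k) : k ≠ .inter → EdgeOK k .left .right k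
  | right_left (k) : k ≠ .inter → EdgeOK k .right .left k
  | parent_childL (k) : k ≠ .inter → EdgeOK k .parent .childL k
  | parent_childR (k) : k ≠ .inter → EdgeOK k .parent .childR k
  | childL_parent (k) : k ≠ .inter → EdgeOK k .childL .parent k
  | childR_parent (k) : k ≠ .inter → EdgeOK k .childR .parent k
  | portA_up : EdgeOK .head .portA .up .port
  | portB_up : EdgeOK .head .portB .up .port
  | up_portA : EdgeOK .port .up .portA .head
  | up_portB : EdgeOK .port .up .portB .head
  | outward_inward : EdgeOK .port .outward .inward .inter
  | inward_outward : EdgeOK .inter .inward .outward .port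

namespace GadgetGraph

variable {V : Type}

/-- The labeled subgraph induced by a set of nodes. -/
def induce (G : GadgetGraph V) (U : Set V) : GadgetGraph U where
  kind u := G.kind u.1
  step a u w := G.step a u.1 w.1

/-- The node `u` has a half-edge with label `a`. -/
def Has (G : GadgetGraph V) (a : HalfKind) (u : V) : Prop := ∃ w, G.step a u w

/-- The constraints of a tree-like gadget at the node `u`. -/
structure TreeOK (G : GadgetGraph V) (u : V) : Prop where
  unique : ∀ a w w', G.step a u w → G.step a u w' → w = w'
  child_iff : G.Has .childL u ↔ G.Has .childR u
  siblings : ∀ x y, G.step .childL u x → G.step .childR u y → G.step .right x y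
  same_depth : ∀ v, G.step .right u v → (G.Has .childL u ↔ G.Has .childL v)
  cousins : ∀ v y x, G.step .right u v → G.step .childR u y → G.step .childL v x →
    G.step .right y x
  right_border : ∀ y, ¬ G.Has .right u → G.step .childR u y → ¬ G.Has .right y
  left_border : ∀ x, ¬ G.Has .left u → G.step .childL u x → ¬ G.Has .left x
  root : ¬ G.Has .parent u → ¬ G.Has .left u ∧ ¬ G.Has .right u

/-- The local constraints at the node `u`. A finite graph satisfies them at all its nodes if and
only if it is a proper instance with the intended labels: the nodes of kind `head` and `port` form
disjoint octopus gadgets, in which every leaf of the head-gadget is joined to the roots of one or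
two port-gadgets; the inter-octopus nodes form an independent set; and the left-most leaf of every
port-gadget, and no other node of an octopus gadget, is joined to an inter-octopus node. -/
structure LocallyOK (G : GadgetGraph V) (u : V) : Prop where
  edge : ∀ a w, G.step a u w → ∃ b, G.step b w u ∧ EdgeOK (G.kind u) a b (G.kind w)
  tree : G.kind u ≠ .inter → G.TreeOK u
  head_leaf : G.kind u = .head → (G.Has .portA u ↔ ¬ G.Has .childL u)
  head_ports : G.kind u = .head → G.Has .portB u → G.Has .portA u
  port_root : G.kind u = .port → (G.Has .up u ↔ ¬ G.Has .parent u)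
  port_leaf : G.kind u = .port →
    (G.Has .outward u ↔ ¬ G.Has .childL u ∧ ¬ G.Has .left u)

/-- `r` is the root of the right-most port-gadget that hangs from the head-gadget leaf `u`. -/
def LastPort (G : GadgetGraph V) (u r : V) : Prop :=
  G.step .portB u r ∨ (G.step .portA u r ∧ ¬ G.Has .portB u)

/-- `r` and `r'` are the roots of two consecutive port-gadgets of the same octopus gadget, in the
left-to-right order. -/
def NextPort (G : GadgetGraph V) (r r' : V) : Prop :=
  ∃ u, (G.step .portA u r ∧ G.step .portB u r') ∨
    ∃ u', G.step .right u u' ∧ G.LastPort u r ∧ G.step .portA u' r'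

/-- The output labeling `y` (where `none` plays the role of `⊥`) solves the promise problem on `G`.
The black constraint is imposed on the inter-octopus nodes whose degree is an admissible
hyperedge size. Adjacent port nodes always belong to the same port-gadget. -/
structure PromiseSolution {S : Type} [Finite V] (P : LinearizableProblem S) (G : GadgetGraph V)
    (y : V → Option S) : Prop where
  bot : ∀ u, G.kind u ≠ .port → y u = none
  lab : ∀ u, G.kind u = .port → ∃ s, y u = some s
  const : ∀ a u w, G.kind u = .port → G.kind w = .port → G.step a u w → y u = y w
  first : ∀ u r, G.kind u = .head → ¬ G.Has .left u → G.step .portA u r →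
    ∃ s ∈ P.first, y r = some s
  last : ∀ u r, G.kind u = .head → ¬ G.Has .right u → G.LastPort u r →
    ∃ s ∈ P.last, y r = some s
  pairs : ∀ r r', G.NextPort r r' → ∃ s t, (s, t) ∈ P.pairs ∧ y r = some s ∧ y r' = some t
  black : ∀ b, G.kind b = .inter → {w | G.step .inward b w}.ncard ∈ P.sizes →
    ∃ m ∈ P.black, (Set.toFinite {w | G.step .inward b w}).toFinset.val.map y = m.map some

end GadgetGraph

/-! ### Proving that a graph is bad, and the lifted problem -/

/-- Outputs for the bad-graph problem: `unmarked` is `⊥`; a marked node either claims a local error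
or points along one of its half-edges towards an error. -/
inductive Mark
  | unmarked
  | error
  | pointer (a : HalfKind)

/-- The phases that a chain of error pointers goes through: to the root of a port-gadget, to the
head-gadget, to the root of the head-gadget, down, sideways, into a port-gadget, down, sideways,
out to an inter-octopus node. The value `0` stands for pointers that are not allowed. -/
def pointerPhase : NodeKind → HalfKind → ℕ
  | .port, .parent => 1
  | .port, .up => 2
  | .head, .parent => 3
  | .head, .childR => 4
  | .head, .left => 5
  | .head, .right => 5
  | .head, .portA => 6
  | .head, .portB => 6
  | .port, .childR => 7
  | .port, .left => 8
  | .port, .right => 8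
  | .port, .outward => 9
  | _, _ => 0

namespace GadgetGraph

variable {V : Type}

/-- The marking `m` solves the bad-graph problem on `G`: errors are claimed only where a local
constraint is violated, every pointer leads to an error or to a pointer that continues in the same
direction or is in a later phase, and the graph induced by the unmarked nodes satisfies the local
constraints. -/
structure BadGraphSolution (G : GadgetGraph V) (m : V → Mark) : Prop where
  error : ∀ u, m u = .error → ¬ G.LocallyOK u
  pointer : ∀ u a, m u = .pointer a → pointerPhase (G.kind u) a ≠ 0 ∧
    ∃ w, G.step a u w ∧ (m w = .error ∨ ∃ b, m w = .pointer b ∧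
      ((b = a ∧ G.kind w = G.kind u) ∨
        pointerPhase (G.kind u) a < pointerPhase (G.kind w) b))
  unmarked : ∀ u : {u // m u = .unmarked}, (G.induce {u | m u = .unmarked}).LocallyOK u

end GadgetGraph

namespace LinearizableProblem

variable {S : Type}

/-- The promise problem: its inputs are the labeled graphs that satisfy the local constraints at all
nodes, with inter-octopus nodes of admissible degrees. -/
def promise (P : LinearizableProblem S) (c : ℕ) :
    DistProblem c NodeKind HalfKind (Option S) where
  inputs := {N | (∀ u, N.gadgetGraph.LocallyOK u) ∧
    ∀ u, N.label u = .inter → N.degree u ∈ P.sizes}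
  Solution N y := N.gadgetGraph.PromiseSolution P y

/-- The lifted problem, an LCL problem on all labeled graphs of maximum degree at most
`max 5 (max P.sizes)`: solve the bad-graph problem, and then the promise problem on the graph
induced by the unmarked nodes. -/
def lift (P : LinearizableProblem S) (c : ℕ) :
    DistProblem c NodeKind HalfKind (Mark × Option S) where
  inputs := {N | ∀ u, N.degree u ≤ max 5 (P.sizes.sup id)}
  Solution N y := N.gadgetGraph.BadGraphSolution (fun u => (y u).1) ∧
    (N.gadgetGraph.induce {u | (y u).1 = .unmarked}).PromiseSolution P (fun u => (y u.1).2)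

end LinearizableProblem

/-! An outcome for the promise problem is turned into one for `P` by running it on an inflated copy
of the input. In an `n`-node bipartite network every white node of positive degree becomes an
octopus gadget with one port-gadget per port, of height `h` close to `log₂ n`, and every black node
becomes an inter-octopus node. A promise solution puts one label on each port-gadget, and its
constraints along the octopus and at the inter-octopus nodes are those of `P`; so the labels of the
port-gadgets form a solution of `P` (`GadgetLift.decode_solution`).

The gain in locality is that an edge of the network has become a path through a port-gadget, which
takes `h` steps to cross (`Near.step`). A view of radius `T` around the roots of the port-gadgets of
`A` is therefore determined by a view of radius `3 * (T / h)` around `A`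
(`GadgetLift.viewIso_of_viewIso`), and the pushed-forward outcome is non-signaling beyond that
distance (`solvableNS_of_promise`). The rounded-down quotient matters: the radius is `0` when `T <
h`, so no additive constant spoils the bound. Two views can be compared only if the inflated
instances have equal size and matching identifiers. Hence each white or black node owns a block of
identifiers computed from its own identifier and `n`, and disjoint stars pad the instance to a
prescribed size `M`. With `2 ^ h ≤ n / 4`, any `M ≥ n ^ 3` is large enough once `n` is large. As `p`
is non-increasing, the failure probability does not grow.

The lifted problem reduces to the promise problem because on a proper instance no node can be marked
(`Proper.unmarked`): there are no errors, each pointer direction is acyclic within one kind of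
gadget, and the phases increase. A solution is then a promise solution on the whole graph.

For the lower bound, all sizes `n` with the same `⌊n^(1/3)⌋ = m` are treated at once, by padding to
a size in `[m ^ 3, (m + 1) ^ 3)` at which the locality of the given outcome is smallest. -/

namespace GadgetGraph

/-! ### Acyclicity of proper gadget graphs, and the absence of marks on them -/

variable {V : Type} {G : GadgetGraph V}

/-- The local constraints hold everywhere, and every edge has only one label at each endpoint. -/
structure Proper (G : GadgetGraph V) : Prop where
  ok : ∀ u, G.LocallyOK u
  label_unique : ∀ a b u w, G.step a u w → G.step b u w → a = b

namespace Proper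

theorem right_of_left (hG : G.Proper) {u w : V} (h : G.step .left u w) : G.step .right w u := by
  obtain ⟨b, hb, he⟩ := (hG.ok u).edge _ _ h
  generalize G.kind u = k at he
  generalize G.kind w = l at he
  cases he
  exact hb

theorem left_of_right (hG : G.Proper) {u w : V} (h : G.step .right u w) : G.step .left w u := by
  obtain ⟨b, hb, he⟩ := (hG.ok u).edge _ _ h
  generalize G.kind u = k at he
  generalize G.kind w = l at he
  cases he
  exact hb

theorem parent_of_childL (hG : G.Proper) {u w : V} (h : G.step .childL u w) :
    G.step .parent w u := by
  obtain ⟨b, hb, he⟩ := (hG.ok u).edge _ _ h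
  generalize G.kind u = k at he
  generalize G.kind w = l at he
  cases he
  exact hb

theorem parent_of_childR (hG : G.Proper) {u w : V} (h : G.step .childR u w) :
    G.step .parent w u := by
  obtain ⟨b, hb, he⟩ := (hG.ok u).edge _ _ h
  generalize G.kind u = k at he
  generalize G.kind w = l at he
  cases he
  exact hb

theorem child_of_parent (hG : G.Proper) {u w : V} (h : G.step .parent u w) :
    G.step .childL w u ∨ G.step .childR w u := by
  obtain ⟨b, hb, he⟩ := (hG.ok u).edge _ _ h
  generalize G.kind u = k at he
  generalize G.kind w = l at he
  cases he
  · exact .inl hb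
  · exact .inr hb

theorem tree (hG : G.Proper) {a : HalfKind} {u w : V} (h : G.step a u w) (ha : a ≠ .inward) :
    G.TreeOK u := by
  refine (hG.ok u).tree fun hk => ?_
  obtain ⟨b, hb, he⟩ := (hG.ok u).edge _ _ h
  rw [hk] at he
  generalize G.kind w = l at he
  cases he <;> simp_all

theorem tree_target (hG : G.Proper) {u w : V} (h : G.step .right u w) : G.TreeOK w :=
  hG.tree (hG.left_of_right h) (by simp)

theorem parent_unique (hG : G.Proper) {u w w' : V} (h : G.step .parent u w)
    (h' : G.step .parent u w') : w = w' :=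
  (hG.tree h (by simp)).unique _ _ _ h h'

/-- Moving right from a left child, one reaches the right child of the same parent and then the left
child of the parent's right neighbor. -/
theorem right_right (hG : G.Proper) {p x y z : V} (hp : G.step .childL p x)
    (hxy : G.step .right x y) (hyz : G.step .right y z) :
    G.step .childR p y ∧ ∃ v, G.step .right p v ∧ G.step .childL v z := by
  have tp := hG.tree hp (by simp)
  obtain ⟨y', hy'⟩ := tp.child_iff.1 ⟨x, hp⟩
  obtain rfl := (hG.tree hxy (by simp)).unique _ _ _ hxy (tp.siblings _ _ hp hy')
  refine ⟨hy', ?_⟩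
  have hr : G.Has .right p := by
    by_contra hr
    exact tp.right_border _ hr hy' ⟨z, hyz⟩
  obtain ⟨v, hv⟩ := hr
  obtain ⟨z', hz'⟩ := (tp.same_depth v hv).1 ⟨x, hp⟩
  obtain rfl := (hG.tree hyz (by simp)).unique _ _ _ hyz (tp.cousins _ _ _ hv hy' hz')
  exact ⟨v, hv, hz'⟩

/-- A node with a right neighbor is not a root. If it is a right child, the `cousins` constraint
makes its neighbor the left child of the next parent. -/
theorem exists_leftChild (hG : G.Proper) {x y : V} (hxy : G.step .right x y) :
    (∃ p, G.step .childL p x) ∨ ∃ p, G.step .childL p y := by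
  have hpar : G.Has .parent x := by
    by_contra h
    exact ((hG.tree hxy (by simp)).root h).2 ⟨y, hxy⟩
  obtain ⟨p, hp⟩ := hpar
  rcases hG.child_of_parent hp with h | h
  · exact .inl ⟨p, h⟩
  · right
    have tp := hG.tree h (by simp)
    have hr : G.Has .right p := by
      by_contra hr
      exact tp.right_border _ hr h ⟨y, hxy⟩
    obtain ⟨v, hv⟩ := hr
    obtain ⟨z', hz'⟩ := (tp.same_depth v hv).1 (tp.child_iff.2 ⟨x, h⟩)
    obtain rfl := (hG.tree hxy (by simp)).unique _ _ _ hxy (tp.cousins _ _ _ hv h hz')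
    exact ⟨v, hz'⟩

/-- Halving: along a closed walk to the right, left and right children alternate, so the parents of
the left children form a closed walk of half the period one level up, and an odd period is
contradictory. -/
theorem not_periodic_right (hG : G.Proper) (L : ℕ) (hL : 0 < L) :
    ∀ g : ℕ → V, (∀ t, G.step .right (g t) (g (t + 1))) → (∀ t, g (t + L) = g t) → False := by
  induction L using Nat.strong_induction_on with
  | _ L ih =>
  have key : ∀ g : ℕ → V, (∀ t, G.step .right (g t) (g (t + 1))) → (∀ t, g (t + L) = g t) →
      (∃ p, G.step .childL p (g 0)) → False := by
    intro g hg hper h0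
    have hp : ∀ t, ∃ p, G.step .childL p (g (2 * t)) := by
      intro t
      induction t with
      | zero => exact h0
      | succ t iht =>
        obtain ⟨p, hp⟩ := iht
        obtain ⟨-, v, -, hv⟩ := hG.right_right hp (hg _) (hg _)
        exact ⟨v, hv⟩
    choose p hp using hp
    rcases Nat.even_or_odd' L with ⟨s, rfl | rfl⟩
    · refine ih s (by omega) (by omega) p (fun t => ?_) (fun t => ?_)
      · obtain ⟨-, v, hv, hv'⟩ := hG.right_right (hp t) (hg _) (hg _)
        have := hG.parent_unique (hG.parent_of_childL hv') (hG.parent_of_childL (hp (t + 1)))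
        rwa [this] at hv
      · have h1 := hp (t + s)
        rw [mul_add, hper] at h1
        exact hG.parent_unique (hG.parent_of_childL h1) (hG.parent_of_childL (hp t))
    -- With odd period the node `g L = g 0` would be both a right child and a left child, which
    -- gives one edge two labels.
    · have h1 := (hG.right_right (hp s) (hg _) (hg _)).1
      have h2 := hper 0
      rw [zero_add] at h2
      rw [h2] at h1
      have h3 := hp 0
      have h4 := hG.parent_unique (hG.parent_of_childR h1) (hG.parent_of_childL h3)
      rw [h4] at h1
      have := hG.label_unique _ _ _ _ h1 h3
      simp at this
  intro g hg hper
  rcases hG.exists_leftChild (hg 0) with h | h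
  · exact key g hg hper h
  · exact key (fun t => g (t + 1)) (fun t => hg _) (fun t => by rw [← hper (t + 1)]; congr 1; omega) h

/-- An infinite walk to the right in a finite graph revisits a node, and from there it is periodic
because right neighbors are unique. -/
theorem wellFounded_right [Finite V] (hG : G.Proper) :
    WellFounded (fun w u => G.step .right u w) := by
  rw [wellFounded_iff_isEmpty_descending_chain]
  refine ⟨fun ⟨f, hf⟩ => ?_⟩
  obtain ⟨i, j, hij, he⟩ := Finite.exists_ne_map_eq_of_infinite f
  wlog hlt : i < j generalizing i j
  · exact this j i hij.symm he.symm (by omega)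
  refine hG.not_periodic_right (j - i) (by omega) (fun t => f (i + t)) (fun t => hf _) fun t => ?_
  have : ∀ t, f (j + t) = f (i + t) := by
    intro t
    induction t with
    | zero => exact he.symm
    | succ t iht =>
      have h1 := hf (j + t)
      rw [iht] at h1
      exact (hG.tree h1 (by simp)).unique _ _ _ h1 (hf (i + t))
  rw [← this t]
  congr 1
  omega

/-- A cycle of parents is impossible: the nodes on the levels of such a cycle would form a finite
set in which every node has two children. -/
theorem irrefl_transGen_parent [Finite V] (hG : G.Proper) (u : V) :
    ¬ Relation.TransGen (fun u w => G.step .parent u w) u u := by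
  intro hu
  let R : V → V → Prop := fun u w => G.step .parent u w
  let U : Set V := {v | ∃ u, Relation.TransGen R u u ∧ Relation.EqvGen (G.step .right) u v}
  have hUr : ∀ v w, v ∈ U → G.step .right v w → w ∈ U := fun v w ⟨u, hu, hv⟩ h =>
    ⟨u, hu, hv.trans _ _ _ (.rel _ _ h)⟩
  have hUl : ∀ v w, v ∈ U → G.step .right w v → w ∈ U := fun v w ⟨u, hu, hv⟩ h =>
    ⟨u, hu, hv.trans _ _ _ (.symm _ _ (.rel _ _ h))⟩
  -- A node on a parent cycle has one child on the cycle, hence both children in `U` by `siblings`.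
  -- The constraints `same_depth`, `cousins` and `siblings` carry this property along the level in
  -- both directions.
  let Q : V → Prop := fun v => ∃ x y, G.step .childL v x ∧ G.step .childR v y ∧ x ∈ U ∧ y ∈ U
  have hQ0 : ∀ u, Relation.TransGen R u u → Q u := by
    intro u hu
    obtain ⟨x, hux, hxu⟩ := Relation.TransGen.tail'_iff.1 hu
    have hx : x ∈ U := ⟨x, Relation.TransGen.head' hxu hux, .refl _⟩
    rcases hG.child_of_parent hxu with h | h
    · have tu := hG.tree h (by simp)
      obtain ⟨y, hy⟩ := tu.child_iff.1 ⟨x, h⟩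
      exact ⟨x, y, h, hy, hx, hUr _ _ hx (tu.siblings _ _ h hy)⟩
    · have tu := hG.tree h (by simp)
      obtain ⟨y, hy⟩ := tu.child_iff.2 ⟨x, h⟩
      exact ⟨y, x, hy, h, hUl _ _ hx (tu.siblings _ _ hy h), hx⟩
  have hQr : ∀ v w, G.step .right v w → (Q v ↔ Q w) := by
    intro v w h
    have tv := hG.tree h (by simp)
    have tw := hG.tree_target h
    constructor
    · rintro ⟨x, y, hx, hy, hxU, hyU⟩
      obtain ⟨x', hx'⟩ := (tv.same_depth w h).1 ⟨x, hx⟩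
      obtain ⟨y', hy'⟩ := tw.child_iff.1 ⟨x', hx'⟩
      have h1 := hUr _ _ hyU (tv.cousins _ _ _ h hy hx')
      exact ⟨x', y', hx', hy', h1, hUr _ _ h1 (tw.siblings _ _ hx' hy')⟩
    · rintro ⟨x, y, hx, hy, hxU, hyU⟩
      obtain ⟨x', hx'⟩ := (tv.same_depth w h).2 ⟨x, hx⟩
      obtain ⟨y', hy'⟩ := tv.child_iff.1 ⟨x', hx'⟩
      have h1 := hUl _ _ hxU (tv.cousins _ _ _ h hy' hx)
      exact ⟨x', y', hx', hy', hUl _ _ h1 (tv.siblings _ _ hx' hy'), h1⟩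
  have hQe : ∀ v w, Relation.EqvGen (G.step .right) v w → (Q v ↔ Q w) := by
    intro v w h
    induction h with
    | rel v w h => exact hQr v w h
    | refl v => rfl
    | symm v w _ ih => exact ih.symm
    | trans u v w _ _ ih1 ih2 => exact ih1.trans ih2
  have hQ : ∀ v : U, Q v := fun ⟨v, u, hu, hv⟩ => (hQe _ _ hv).1 (hQ0 u hu)
  choose x y hx hy hxU hyU using hQ
  have : Fintype U := Fintype.ofFinite U
  -- Parents are unique and an edge has one label, so all these children are distinct and `2 * |U| ≤
  -- |U|`.
  let F : U × Bool → U := fun p => if p.2 then ⟨x p.1, hxU p.1⟩ else ⟨y p.1, hyU p.1⟩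
  have hF : Function.Injective F := by
    have hxy : ∀ v w : U, x v ≠ y w := by
      intro v w h
      have h1 := hx v
      have h2 := hy w
      rw [h] at h1
      rw [hG.parent_unique (hG.parent_of_childL h1) (hG.parent_of_childR h2)] at h1
      exact absurd (hG.label_unique _ _ _ _ h1 h2) (by simp)
    rintro ⟨v, _ | _⟩ ⟨w, _ | _⟩ h <;> simp only [F, Subtype.mk.injEq, if_true, if_false,
      Bool.false_eq_true] at h
    · have h1 := hy v
      rw [h] at h1
      have := hG.parent_unique (hG.parent_of_childR h1) (hG.parent_of_childR (hy w))
      rw [Subtype.ext this]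
    · exact absurd h.symm (hxy _ _)
    · exact absurd h (hxy _ _)
    · have h1 := hx v
      rw [h] at h1
      have := hG.parent_unique (hG.parent_of_childL h1) (hG.parent_of_childL (hx w))
      rw [Subtype.ext this]
  have hcard := Fintype.card_le_of_injective F hF
  have hpos : 0 < Fintype.card U := Fintype.card_pos_iff.2 ⟨⟨u, u, hu, .refl _⟩⟩
  rw [Fintype.card_prod, Fintype.card_bool] at hcard
  omega

theorem _root_.wellFounded_of_irrefl_transGen {α : Type*} [Finite α] {r : α → α → Prop}
    (h : ∀ a, ¬ Relation.TransGen r a a) : WellFounded r := by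
  have : Std.Irrefl (Relation.TransGen r) := ⟨h⟩
  exact Subrelation.wf (fun h => Relation.TransGen.single h)
    (Finite.wellFounded_of_trans_of_irrefl (Relation.TransGen r))

theorem _root_.wellFounded_swap {α : Type*} [Finite α] {r : α → α → Prop} (h : WellFounded r) :
    WellFounded (Function.swap r) := by
  refine wellFounded_of_irrefl_transGen fun a ha => ?_
  rw [Relation.transGen_swap] at ha
  exact h.transGen.irrefl.irrefl a ha

/-- Sideways and vertical moves are acyclic by the two results above, `childL` is never a pointer,
and each remaining label leads to a node of another kind. -/
theorem wellFounded_pointer [Finite V] (hG : G.Proper) {a : HalfKind} {k : NodeKind}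
    (ha : pointerPhase k a ≠ 0) :
    WellFounded (fun w u => G.step a u w ∧ G.kind u = k ∧ G.kind w = k) := by
  have hpar : WellFounded (fun u w => G.step .parent u w) :=
    wellFounded_of_irrefl_transGen hG.irrefl_transGen_parent
  have hne : ∀ a, (∀ b, ¬ EdgeOK k a b k) →
      WellFounded (fun w u => G.step a u w ∧ G.kind u = k ∧ G.kind w = k) := by
    intro a h
    refine ⟨fun w => ⟨_, fun u ⟨hu, hk, hk'⟩ => ?_⟩⟩
    obtain ⟨b, -, hb⟩ := (hG.ok _).edge _ _ hu
    rw [hk, hk'] at hb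
    exact absurd hb (h b)
  cases a
  · exact Subrelation.wf (fun h => hG.right_of_left h.1) (wellFounded_swap hG.wellFounded_right)
  · exact Subrelation.wf (fun h => h.1) hG.wellFounded_right
  · exact Subrelation.wf (fun h => h.1) (wellFounded_swap hpar)
  · cases k <;> simp [pointerPhase] at ha
  · exact Subrelation.wf (fun h => hG.parent_of_childR h.1) hpar
  all_goals
    refine hne _ fun b hb => ?_
    cases k <;> cases hb

/-- On a proper instance nobody can be marked. -/
theorem unmarked [Finite V] (hG : G.Proper) {m : V → Mark} (hm : G.BadGraphSolution m) (u : V) :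
    m u = .unmarked := by
  have herr : ∀ u, m u ≠ .error := fun u h => hm.error u h (hG.ok u)
  -- Outer induction on the number of phases left (`9` is the last phase); within a fixed label and
  -- kind, inner induction along `wellFounded_pointer`.
  have hptr : ∀ (j : ℕ) u a, 9 - pointerPhase (G.kind u) a = j → m u ≠ .pointer a := by
    intro j
    induction j using Nat.strong_induction_on with
    | _ j ih =>
    intro u a hj hu
    have hph := (hm.pointer u a hu).1
    have hwf := hG.wellFounded_pointer hph
    have : ∀ w, G.kind w = G.kind u → m w ≠ .pointer a := by
      intro w
      induction w using hwf.induction with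
      | _ w ihw =>
      intro hk hw
      obtain ⟨-, z, hz, h | ⟨b, hb, ⟨rfl, hk'⟩ | hlt⟩⟩ := hm.pointer w a hw
      · exact herr z h
      · exact ihw z ⟨hz, hk, hk'.trans hk⟩ (hk'.trans hk) hb
      · rw [hk] at hlt
        have h9 : ∀ k b, pointerPhase k b ≤ 9 := by
          intro k b; cases k <;> cases b <;> simp [pointerPhase]
        have := h9 (G.kind z) b
        exact ih (9 - pointerPhase (G.kind z) b) (by omega) z b rfl hb
    exact this u rfl hu
  cases h : m u with
  | unmarked => rfl
  | error => exact absurd h (herr u)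
  | pointer a => exact absurd h (hptr _ u a rfl)

end Proper

end GadgetGraph

/-! ### From the lifted problem to the promise problem -/

theorem Set.toFinset_image_val_map {α β γ : Type*} [Finite α] [Finite β] {f : α → β} {s : Set α}
    {t : Set β} (hf : Set.InjOn f s) (hst : f '' s = t) (g : β → γ) :
    (Set.toFinite t).toFinset.val.map g = (Set.toFinite s).toFinset.val.map (g ∘ f) := by
  classical
  subst hst
  have : (Set.toFinite (f '' s)).toFinset = (Set.toFinite s).toFinset.image f := by
    ext; simp
  rw [this, Finset.image_val_of_injOn (by simpa using hf), Multiset.map_map]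

namespace Network

variable {c : ℕ} {X Y : Type}

theorem degree_eq_length (N : Network c X Y) (v : N.V) : N.degree v = (N.halfLabels v).length := by
  have h := (N.port_bijOn v).image_eq
  have h2 := (N.port_bijOn v).injOn.ncard_image
  rw [h] at h2
  rw [degree, ← h2, ← Nat.card_coe_set_eq]
  simp [Nat.card_eq_fintype_card]

theorem port_lt (N : Network c X Y) {u w : N.V} (h : N.graph.Adj u w) :
    N.port u w < (N.halfLabels u).length :=
  (N.port_bijOn u).mapsTo h

theorem exists_step (N : Network c NodeKind HalfKind) {u w : N.V} (h : N.graph.Adj u w) :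
    ∃ a, N.gadgetGraph.step a u w :=
  ⟨_, h, List.getElem?_eq_getElem (N.port_lt h)⟩

theorem proper_gadgetGraph (N : Network c NodeKind HalfKind)
    (h : ∀ u, N.gadgetGraph.LocallyOK u) : N.gadgetGraph.Proper where
  ok := h
  label_unique _ _ _ _ ha hb := Option.some.inj (ha.2.symm.trans hb.2)

end Network

namespace GadgetGraph

variable {V : Type} {G : GadgetGraph V}

theorem LocallyOK.has_ne {u : V} (h : G.LocallyOK u) {a : HalfKind} {k : NodeKind}
    (ha : G.Has a u) (hk : G.kind u = k) : ∃ b l, EdgeOK k a b l := by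
  obtain ⟨w, hw⟩ := ha
  obtain ⟨b, -, hb⟩ := h.edge a w hw
  exact ⟨b, _, hk ▸ hb⟩

/-- This is where the degree bound `5` comes from: having children excludes having port-gadgets, and
excludes an outward edge, while in a port-gadget having a parent excludes `up`. -/
theorem LocallyOK.exists_list_has {u : V} (h : G.LocallyOK u) (hu : G.kind u ≠ .inter) :
    ∃ l : List HalfKind, l.length ≤ 5 ∧ ∀ a, G.Has a u → a ∈ l := by
  have ht := h.tree hu
  cases hk : G.kind u with
  | inter => exact absurd hk hu
  | head =>
    have hne : ∀ a, G.Has a u → a ≠ .up ∧ a ≠ .outward ∧ a ≠ .inward := by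
      intro a ha
      obtain ⟨b, l, hb⟩ := h.has_ne ha hk
      cases hb <;> simp
    have h1 := h.head_leaf hk
    have h2 := h.head_ports hk
    have h3 := ht.child_iff
    by_cases hc : G.Has .childL u
    · refine ⟨[.left, .right, .parent, .childL, .childR], by simp, fun a ha => ?_⟩
      have := hne a ha
      cases a <;> simp_all
    · refine ⟨[.left, .right, .parent, .portA, .portB], by simp, fun a ha => ?_⟩
      have := hne a ha
      cases a <;> simp_all
  | port =>
    have hne : ∀ a, G.Has a u → a ≠ .portA ∧ a ≠ .portB ∧ a ≠ .inward := by
      intro a ha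
      obtain ⟨b, l, hb⟩ := h.has_ne ha hk
      cases hb <;> simp
    have h1 := h.port_root hk
    have h2 := h.port_leaf hk
    have h3 := ht.child_iff
    by_cases hc : G.Has .childL u
    · by_cases hp : G.Has .parent u
      · refine ⟨[.left, .right, .parent, .childL, .childR], by simp, fun a ha => ?_⟩
        have := hne a ha
        cases a <;> simp_all
      · refine ⟨[.left, .right, .up, .childL, .childR], by simp, fun a ha => ?_⟩
        have := hne a ha
        cases a <;> simp_all
    · refine ⟨[.left, .right, .parent, .up, .outward], by simp, fun a ha => ?_⟩
      have := hne a ha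
      cases a <;> simp_all

/-- A solution on the subgraph induced by all nodes is a solution. -/
theorem PromiseSolution.of_induce {S : Type} [Finite V] {P : LinearizableProblem S} {U : Set V}
    (hU : ∀ u, u ∈ U) {y : V → Option S}
    (h : (G.induce U).PromiseSolution P (fun u => y u.1)) : G.PromiseSolution P y where
  bot u hu := h.bot ⟨u, hU u⟩ hu
  lab u hu := h.lab ⟨u, hU u⟩ hu
  const a u w hu hw hs := h.const a ⟨u, hU u⟩ ⟨w, hU w⟩ hu hw hs
  first u r hu hl hs := h.first ⟨u, hU u⟩ ⟨r, hU r⟩ hu (fun ⟨w, hw⟩ => hl ⟨w.1, hw⟩) hs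
  last u r hu hl hs := h.last ⟨u, hU u⟩ ⟨r, hU r⟩ hu (fun ⟨w, hw⟩ => hl ⟨w.1, hw⟩)
    (hs.imp id fun hs => ⟨hs.1, fun ⟨w, hw⟩ => hs.2 ⟨w.1, hw⟩⟩)
  pairs r r' hs := by
    refine h.pairs ⟨r, hU r⟩ ⟨r', hU r'⟩ ?_
    obtain ⟨u, hs | ⟨u', h1, h2, h3⟩⟩ := hs
    · exact ⟨⟨u, hU u⟩, .inl hs⟩
    · exact ⟨⟨u, hU u⟩, .inr ⟨⟨u', hU u'⟩, h1,
        h2.imp id fun hs => ⟨hs.1, fun ⟨w, hw⟩ => hs.2 ⟨w.1, hw⟩⟩, h3⟩⟩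
  black b hb hs := by
    have him : Subtype.val '' {w : U | (G.induce U).step .inward ⟨b, hU b⟩ w} =
        {w | G.step .inward b w} := by
      ext w
      exact ⟨fun ⟨z, hz, hzw⟩ => hzw ▸ hz, fun hw => ⟨⟨w, hU w⟩, hw, rfl⟩⟩
    rw [← him, Set.ncard_image_of_injective _ Subtype.val_injective] at hs
    obtain ⟨m, hm, he⟩ := h.black ⟨b, hU b⟩ hb hs
    exact ⟨m, hm, (Set.toFinset_image_val_map Subtype.val_injective.injOn him y).trans he⟩

end GadgetGraph

namespace LinearizableProblem

variable {S : Type} (P : LinearizableProblem S) {c : ℕ}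

/-- A gadget node has at most one half-edge per label, so its degree is bounded by the number of
available labels; the degree of an inter-octopus node is an admissible size by assumption. -/
theorem promise_inputs_subset_lift : (P.promise c).inputs ⊆ (P.lift c).inputs := by
  classical
  rintro N ⟨hN, hD⟩ u
  by_cases hu : N.label u = .inter
  · exact (Finset.le_sup (f := id) (hD u hu)).trans (le_max_right _ _)
  refine le_max_of_le_left ?_
  obtain ⟨l, hl, hmem⟩ := (hN u).exists_list_has hu
  have : ∀ w, ∃ a, N.graph.Adj u w → N.gadgetGraph.step a u w := fun w => by
    by_cases h : N.graph.Adj u w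
    · exact (N.exists_step h).imp fun a ha _ => ha
    · exact ⟨.left, fun h' => absurd h' h⟩
  choose f hf using this
  calc N.degree u ≤ (l.toFinset : Set HalfKind).ncard := by
        refine Set.ncard_le_ncard_of_injOn f (fun w hw => ?_) (fun w hw w' hw' he => ?_)
          (Finset.finite_toSet _)
        · simpa using hmem _ ⟨w, hf w hw⟩
        · refine ((hN u).tree hu).unique _ _ _ (hf w hw) ?_
          rw [he]
          exact hf w' hw'
    _ = l.toFinset.card := Set.ncard_coe_finset _
    _ ≤ 5 := (List.toFinset_card_le l).trans hl

/-- On proper instances, every outcome for the lifted problem yields one for the promise problem. -/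
theorem promise_solvableNS_of_lift {p : ℕ → ℝ} {T : ℕ → ℕ} (h : (P.lift c).SolvableNS p T) :
    (P.promise c).SolvableNS p T := by
  obtain ⟨O, hO, hs⟩ := h
  refine ⟨fun N => (O N).map fun y u => (y u).2, fun G hG H hH hn A B φ h0 hT => ?_,
    fun N hN => ?_⟩
  · have := hO G (P.promise_inputs_subset_lift hG) H (P.promise_inputs_subset_lift hH) hn A B φ h0 hT
    have := congrArg (PMF.map fun (y : A → Mark × Option S) a => (y a).2) this
    simpa only [PMF.map_comp, Function.comp_def] using this
  · refine le_trans ?_ (hs N (P.promise_inputs_subset_lift hN))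
    rw [PMF.toOuterMeasure_map_apply]
    refine MeasureTheory.measure_mono fun y hy hsol => hy ?_
    have hsol : N.gadgetGraph.BadGraphSolution (fun u => (y u).1) ∧
      (N.gadgetGraph.induce {u | (y u).1 = .unmarked}).PromiseSolution P (fun u => (y u.1).2) := hsol
    exact .of_induce (fun u => (N.proper_gadgetGraph hN.1).unmarked hsol.1 u) hsol.2

end LinearizableProblem

/-! ### Octopus graphs in heap coordinates -/

/-- A port-numbered bipartite graph whose nodes are coloured white and not white: the `i`-th
half-edge of `v` leads to `nb v i`, where it is the `back v i`-th half-edge. The port-gadgets of the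
white node `v` will have height `ht v`. -/
structure Layout (V : Type) where
  white : V → Prop
  deg : V → ℕ
  nb : V → ℕ → V
  back : V → ℕ → ℕ
  ht : V → ℕ
  ht_pos : ∀ v, 0 < ht v
  white_nb : ∀ v i, i < deg v → (white (nb v i) ↔ ¬ white v)
  back_lt : ∀ v i, i < deg v → back v i < deg (nb v i)
  nb_back : ∀ v i, i < deg v → nb (nb v i) (back v i) = v
  back_back : ∀ v i, i < deg v → back (nb v i) (back v i) = i

/-- Encodes the borders of the levels in heap order: node `k ≥ 1` is the left-most of its level if
and only if `k` is a power of two, and the right-most if and only if `k + 1` is. -/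
def IsTwoPow (k : ℕ) : Prop := ∃ e, k = 2 ^ e

theorem isTwoPow_one : IsTwoPow 1 := ⟨0, rfl⟩

theorem isTwoPow_pow (e : ℕ) : IsTwoPow (2 ^ e) := ⟨e, rfl⟩

theorem IsTwoPow.two_mul {k : ℕ} (h : IsTwoPow k) : IsTwoPow (2 * k) := by
  obtain ⟨e, rfl⟩ := h
  exact ⟨e + 1, by ring⟩

theorem IsTwoPow.of_two_mul {k : ℕ} (hk : IsTwoPow (2 * k)) : IsTwoPow k := by
  obtain ⟨_ | e, he⟩ := hk
  · omega
  · exact ⟨e, by rw [pow_succ] at he; omega⟩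

theorem not_isTwoPow_two_mul_add_one {k : ℕ} (hk : k ≠ 0) : ¬ IsTwoPow (2 * k + 1) := by
  rintro ⟨_ | e, he⟩
  · simp at he; omega
  · rw [pow_succ] at he; omega

theorem not_isTwoPow_of_lt {k e : ℕ} (h1 : 2 ^ e < k) (h2 : k < 2 ^ (e + 1)) : ¬ IsTwoPow k := by
  rintro ⟨i, rfl⟩
  rw [Nat.pow_lt_pow_iff_right (by norm_num)] at h1 h2
  omega

namespace Layout

variable {V : Type} (L : Layout V)

/-- The leaf of the head-gadget from which the `i`-th of `d` port-gadgets hangs. -/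
def leafOf (d i : ℕ) : ℕ := 2 ^ Nat.log 2 d + max (i / 2) (i - (d - 2 ^ Nat.log 2 d))

/-- The heights of the gadgets of `v`: gadget `0` is the head-gadget, gadget `i + 1` is the `i`-th
port-gadget. -/
def hgt (v : V) : ℕ → ℕ
  | 0 => Nat.log 2 (L.deg v) + 1
  | _ + 1 => L.ht v

theorem hgt_pos (v : V) (t : ℕ) : 0 < L.hgt v t := by
  cases t
  · exact Nat.succ_pos _
  · exact L.ht_pos v

/-- `(v, t, k)` with `k ≠ 0` is the `k`-th node, in heap order, of gadget `t` of the white node `v`;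
`(v, 0, 0)` is the inter-octopus node of the black node `v`. -/
def Valid (x : V × ℕ × ℕ) : Prop :=
  (L.white x.1 ∧ 0 < L.deg x.1 ∧ x.2.1 ≤ L.deg x.1 ∧ x.2.2 ≠ 0 ∧ x.2.2 < 2 ^ L.hgt x.1 x.2.1) ∨
    (¬ L.white x.1 ∧ x.2.1 = 0 ∧ x.2.2 = 0)

def kind (x : V × ℕ × ℕ) : NodeKind :=
  if x.2.2 = 0 then .inter else if x.2.1 = 0 then .head else .port

/-- The octopus node `x` has a half-edge with label `a`. -/
def Can (a : HalfKind) (x : V × ℕ × ℕ) : Prop :=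
  match a with
  | .left => ¬ IsTwoPow x.2.2
  | .right => ¬ IsTwoPow (x.2.2 + 1)
  | .parent => 2 ≤ x.2.2
  | .childL => 2 * x.2.2 < 2 ^ L.hgt x.1 x.2.1
  | .childR => 2 * x.2.2 < 2 ^ L.hgt x.1 x.2.1
  | .portA => x.2.1 = 0 ∧ 2 ^ Nat.log 2 (L.deg x.1) ≤ x.2.2
  | .portB => x.2.1 = 0 ∧ 2 ^ Nat.log 2 (L.deg x.1) ≤ x.2.2 ∧
      x.2.2 - 2 ^ Nat.log 2 (L.deg x.1) < L.deg x.1 - 2 ^ Nat.log 2 (L.deg x.1)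
  | .up => x.2.1 ≠ 0 ∧ x.2.2 = 1
  | .outward => x.2.1 ≠ 0 ∧ x.2.2 = 2 ^ (L.ht x.1 - 1)
  | .inward => False

/-- The other endpoint of the half-edge with label `a` of the octopus node `x`. -/
def dest (a : HalfKind) (x : V × ℕ × ℕ) : V × ℕ × ℕ :=
  match a with
  | .left => (x.1, x.2.1, x.2.2 - 1)
  | .right => (x.1, x.2.1, x.2.2 + 1)
  | .parent => (x.1, x.2.1, x.2.2 / 2)
  | .childL => (x.1, x.2.1, 2 * x.2.2)
  | .childR => (x.1, x.2.1, 2 * x.2.2 + 1)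
  | .portA => (x.1, x.2.2 - 2 ^ Nat.log 2 (L.deg x.1) +
      min (x.2.2 - 2 ^ Nat.log 2 (L.deg x.1)) (L.deg x.1 - 2 ^ Nat.log 2 (L.deg x.1)) + 1, 1)
  | .portB => (x.1, 2 * (x.2.2 - 2 ^ Nat.log 2 (L.deg x.1)) + 2, 1)
  | .up => (x.1, 0, leafOf (L.deg x.1) (x.2.1 - 1))
  | .outward => (L.nb x.1 (x.2.1 - 1), 0, 0)
  | .inward => x

/-- The left-most leaf of the port-gadget that is joined to the black node `b` at its port `j`. -/
def inDest (b : V) (j : ℕ) : V × ℕ × ℕ :=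
  (L.nb b j, L.back b j + 1, 2 ^ (L.ht (L.nb b j) - 1))

/-- At an octopus node the label determines the target. At an inter-octopus node all half-edges have
the label `inward`, and only the port `j` tells them apart. -/
def step (a : HalfKind) (x y : V × ℕ × ℕ) : Prop :=
  (x.2.2 ≠ 0 ∧ L.Can a x ∧ y = L.dest a x) ∨
    (x.2.2 = 0 ∧ a = .inward ∧ ∃ j < L.deg x.1, y = L.inDest x.1 j)

variable {L}

theorem step_octopus {a : HalfKind} {x y : V × ℕ × ℕ} (hx : x.2.2 ≠ 0) :
    L.step a x y ↔ L.Can a x ∧ y = L.dest a x := by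
  simp [step, hx]

theorem step_inter {a : HalfKind} {x y : V × ℕ × ℕ} (hx : x.2.2 = 0) :
    L.step a x y ↔ a = .inward ∧ ∃ j < L.deg x.1, y = L.inDest x.1 j := by
  simp [step, hx]

theorem pow_log_le {d : ℕ} (hd : 0 < d) : 2 ^ Nat.log 2 d ≤ d := Nat.pow_log_le_self 2 hd.ne'

theorem lt_two_mul_pow_log (d : ℕ) : d < 2 * 2 ^ Nat.log 2 d := by
  have := Nat.lt_pow_succ_log_self (b := 2) (by norm_num) d
  rw [pow_succ] at this
  omega

theorem exists_hgt (v : V) (t : ℕ) : ∃ e, L.hgt v t = e + 1 ∧ 2 ^ L.hgt v t = 2 * 2 ^ e := by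
  obtain ⟨e, he⟩ := Nat.exists_eq_succ_of_ne_zero (L.hgt_pos v t).ne'
  exact ⟨e, he, by rw [he, pow_succ]; ring⟩

theorem Valid.octopus {v : V} {t k : ℕ} (h : L.Valid (v, t, k)) (hk : k ≠ 0) :
    L.white v ∧ 0 < L.deg v ∧ t ≤ L.deg v ∧ k < 2 ^ L.hgt v t := by
  rcases h with ⟨h1, h2, h3, -, h4⟩ | ⟨-, -, h⟩
  · exact ⟨h1, h2, h3, h4⟩
  · exact absurd h hk

theorem valid_octopus {v : V} {t k : ℕ} (h1 : L.white v) (h2 : 0 < L.deg v) (h3 : t ≤ L.deg v)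
    (hk : k ≠ 0) (h4 : k < 2 ^ L.hgt v t) : L.Valid (v, t, k) :=
  .inl ⟨h1, h2, h3, hk, h4⟩

theorem valid_inter {v : V} (h : ¬ L.white v) : L.Valid (v, 0, 0) := .inr ⟨h, rfl, rfl⟩

theorem Valid.inter {v : V} {t : ℕ} (h : L.Valid (v, t, 0)) : ¬ L.white v ∧ t = 0 := by
  rcases h with ⟨-, -, -, h, -⟩ | ⟨h1, h2, -⟩
  · exact absurd rfl h
  · exact ⟨h1, h2⟩

theorem valid_inDest {b : V} (hb : ¬ L.white b) {j : ℕ} (hj : j < L.deg b) :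
    L.Valid (L.inDest b j) := by
  have h := L.back_lt b j hj
  refine valid_octopus ((L.white_nb b j hj).2 hb) (by omega) (by omega) (by positivity) ?_
  exact Nat.pow_lt_pow_right (by norm_num) (Nat.sub_lt (L.ht_pos _) one_pos)

theorem kind_octopus {v : V} {t k : ℕ} (hk : k ≠ 0) :
    kind (v, t, k) = if t = 0 then .head else .port := by simp [kind, hk]

theorem kind_inter {v : V} {t : ℕ} : kind (v, t, 0) = .inter := by simp [kind]

theorem kind_octopus_ne {v : V} {t k : ℕ} (hk : k ≠ 0) : kind (v, t, k) ≠ .inter := by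
  rw [kind_octopus hk]; split <;> simp

theorem kind_congr {v v' : V} {t k k' : ℕ} (hk : k ≠ 0) (hk' : k' ≠ 0) :
    kind (v, t, k) = kind (v', t, k') := by rw [kind_octopus hk, kind_octopus hk']

theorem leafOf_ne_zero (d i : ℕ) : leafOf d i ≠ 0 := by
  have : 0 < 2 ^ Nat.log 2 d := by positivity
  unfold leafOf
  omega

/-- This symmetry makes `step` an undirected graph on the valid nodes: heap arithmetic inside a
tree, the inverse formulas of `leafOf` and of the port indices between trees, and `nb_back`,
`back_back` across black nodes. -/
theorem edge {a : HalfKind} {x y : V × ℕ × ℕ} (hx : L.Valid x) (h : L.step a x y) :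
    L.Valid y ∧ ∃ b, L.step b y x ∧ EdgeOK (kind x) a b (kind y) := by
  obtain ⟨v, t, k⟩ := x
  rcases h with ⟨hk, hc, rfl⟩ | ⟨hk, rfl, j, hj, rfl⟩
  · dsimp only at hk
    obtain ⟨hw, hd, ht, hlt⟩ := hx.octopus hk
    obtain ⟨e, he, hpe⟩ := L.exists_hgt v t
    have hki := kind_octopus_ne (v := v) (t := t) hk
    have hq := pow_log_le hd
    have hq' := lt_two_mul_pow_log (L.deg v)
    cases a <;> simp only [Can, dest] at hc ⊢
    · have h1 : k ≠ 1 := fun h => hc (h ▸ isTwoPow_one)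
      have h2 : k - 1 ≠ 0 := by omega
      refine ⟨valid_octopus hw hd ht h2 (by omega), .right, (step_octopus h2).2 ⟨?_, ?_⟩, ?_⟩
      · simpa only [Can, Nat.sub_add_cancel (Nat.one_le_iff_ne_zero.2 hk)] using hc
      · simp only [dest, Nat.sub_add_cancel (Nat.one_le_iff_ne_zero.2 hk)]
      · rw [kind_congr (v' := v) h2 hk]; exact .left_right _ hki
    · have h2 : k + 1 ≠ 0 := by omega
      have h3 : k + 1 ≠ 2 ^ L.hgt v t := fun h => hc (h ▸ isTwoPow_pow _)
      refine ⟨valid_octopus hw hd ht h2 (by omega), .left, (step_octopus h2).2 ⟨hc, rfl⟩, ?_⟩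
      rw [kind_congr (v' := v) h2 hk]; exact .right_left _ hki
    · have h2 : k / 2 ≠ 0 := by omega
      refine ⟨valid_octopus hw hd ht h2 (by omega), ?_⟩
      rw [kind_congr (v := v) (v' := v) h2 hk]
      rcases Nat.even_or_odd' k with ⟨s, rfl | rfl⟩
      · refine ⟨.childL, (step_octopus h2).2 ⟨?_, ?_⟩, .parent_childL _ hki⟩
        · simp only [Can]; omega
        · simp only [dest, Prod.mk.injEq, true_and]; omega
      · refine ⟨.childR, (step_octopus h2).2 ⟨?_, ?_⟩, .parent_childR _ hki⟩
        · simp only [Can]; omega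
        · simp only [dest, Prod.mk.injEq, true_and]; omega
    · have h2 : 2 * k ≠ 0 := by omega
      refine ⟨valid_octopus hw hd ht h2 hc, .parent, (step_octopus h2).2 ⟨?_, ?_⟩, ?_⟩
      · simp only [Can]; omega
      · simp only [dest, Prod.mk.injEq, true_and]; omega
      · rw [kind_congr (v' := v) h2 hk]; exact .childL_parent _ hki
    · have h2 : 2 * k + 1 ≠ 0 := by omega
      refine ⟨valid_octopus hw hd ht h2 (by omega), .parent, (step_octopus h2).2 ⟨?_, ?_⟩, ?_⟩
      · simp only [Can]; omega
      · simp only [dest, Prod.mk.injEq, true_and]; omega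
      · rw [kind_congr (v' := v) h2 hk]; exact .childR_parent _ hki
    · obtain ⟨rfl, hc⟩ := hc
      simp only [hgt, pow_succ] at hlt
      refine ⟨valid_octopus hw hd (by omega) one_ne_zero
        (Nat.one_lt_two_pow (L.hgt_pos _ _).ne'), .up, (step_octopus one_ne_zero).2 ⟨?_, ?_⟩, ?_⟩
      · simp [Can]
      · simp only [dest, leafOf, Prod.mk.injEq, true_and]; omega
      · rw [kind_octopus hk, kind_octopus one_ne_zero]; exact .portA_up
    · obtain ⟨rfl, hc, hc'⟩ := hc
      refine ⟨valid_octopus hw hd (by omega) one_ne_zero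
        (Nat.one_lt_two_pow (L.hgt_pos _ _).ne'), .up, (step_octopus one_ne_zero).2 ⟨?_, ?_⟩, ?_⟩
      · simp [Can]
      · simp only [dest, leafOf, Prod.mk.injEq, true_and]; omega
      · rw [kind_octopus hk, kind_octopus one_ne_zero]; exact .portB_up
    · obtain ⟨ht0, rfl⟩ := hc
      obtain ⟨i, rfl⟩ := Nat.exists_eq_succ_of_ne_zero ht0
      simp only [Nat.succ_eq_add_one, Nat.add_sub_cancel] at ht ⊢
      have h2 := leafOf_ne_zero (L.deg v) i
      refine ⟨valid_octopus hw hd (by omega) h2 ?_, ?_⟩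
      · simp only [hgt, pow_succ, leafOf]; omega
      rw [kind_octopus hk, kind_octopus h2]
      -- With `q = 2 ^ Nat.log 2 d` leaves and `d` port-gadgets, the first `d - q` leaves carry two
      -- of them and the others one. So gadget `i` is a second one exactly when `i` is odd and less
      -- than `2 * (d - q)`.
      by_cases hi : i < 2 * (L.deg v - 2 ^ Nat.log 2 (L.deg v)) ∧ i % 2 = 1
      · refine ⟨.portB, (step_octopus h2).2 ⟨?_, ?_⟩, .up_portB⟩
        · simp only [Can, leafOf, true_and]; omega
        · simp only [dest, leafOf, Prod.mk.injEq, true_and, and_true]; omega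
      · refine ⟨.portA, (step_octopus h2).2 ⟨?_, ?_⟩, .up_portA⟩
        · simp only [Can, leafOf, true_and]; omega
        · simp only [dest, leafOf, Prod.mk.injEq, true_and, and_true]; omega
    · obtain ⟨ht0, rfl⟩ := hc
      obtain ⟨i, rfl⟩ := Nat.exists_eq_succ_of_ne_zero ht0
      simp only [Nat.succ_eq_add_one, Nat.add_sub_cancel] at ht ⊢
      have hi : i < L.deg v := by omega
      refine ⟨valid_inter (by rw [L.white_nb v i hi]; simpa using hw), .inward,
        (step_inter rfl).2 ⟨rfl, L.back v i, L.back_lt v i hi, ?_⟩, ?_⟩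
      · simp only [inDest, L.nb_back v i hi, L.back_back v i hi]
      · rw [kind_octopus hk, kind_inter]; exact .outward_inward
  · dsimp only at hk hj ⊢
    subst hk
    obtain ⟨hb, rfl⟩ := hx.inter
    have h2 : 2 ^ (L.ht (L.nb v j) - 1) ≠ 0 := by positivity
    refine ⟨valid_inDest hb hj, .outward, (step_octopus h2).2 ⟨?_, ?_⟩, ?_⟩
    · simp [Can, inDest]
    · simp [dest, inDest, L.nb_back v j hj]
    · rw [inDest, kind_octopus h2, kind_inter]; exact .inward_outward

/-- In a simple graph an edge gets one label at each endpoint. The heap formulas could collide only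
for `k ≤ 2` (for instance `right` and `childL` at the root), and there the border conditions remove
the sideways edge. -/
theorem dest_injective {a b : HalfKind} {x : V × ℕ × ℕ} (hk : x.2.2 ≠ 0) (ha : L.Can a x)
    (hb : L.Can b x) (h : L.dest a x = L.dest b x) : a = b := by
  obtain ⟨v, t, k⟩ := x
  have h1 : ¬ IsTwoPow k → k ≠ 1 ∧ k ≠ 2 :=
    fun h => ⟨fun h' => h (h' ▸ isTwoPow_one), fun h' => h (h' ▸ isTwoPow_pow 1)⟩
  have h2 : ¬ IsTwoPow (k + 1) → k ≠ 1 :=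
    fun h h' => h (by subst h'; exact isTwoPow_pow 1)
  have h3 := leafOf_ne_zero (L.deg v) (t - 1)
  cases a <;> cases b <;> simp only [Can, dest, Prod.mk.injEq, true_and] at ha hb h hk <;>
    first | rfl | omega | (exfalso; have := h1 ha; omega) | (exfalso; have := h1 hb; omega) |
      (exfalso; have := h2 ha; omega) | (exfalso; have := h2 hb; omega)

theorem not_step_self {a : HalfKind} {x : V × ℕ × ℕ} : ¬ L.step a x x := by
  obtain ⟨v, t, k⟩ := x
  rintro (⟨hk, hc, h⟩ | ⟨hk, rfl, j, hj, h⟩)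
  · cases a <;> simp only [Can, dest, Prod.mk.injEq, true_and] at hc h hk <;> omega
  · have : 2 ^ (L.ht (L.nb v j) - 1) ≠ 0 := by positivity
    simp only [inDest, Prod.mk.injEq] at h hk
    omega

variable (L) in
/-- The gadget graph in which every white node of positive degree is replaced by an octopus gadget. -/
def gadgetGraph : GadgetGraph {x // L.Valid x} where
  kind x := kind x.1
  step a x y := L.step a x.1 y.1

theorem has_iff {a : HalfKind} {x : {x // L.Valid x}} (hx : x.1.2.2 ≠ 0) :
    L.gadgetGraph.Has a x ↔ L.Can a x.1 := by
  constructor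
  · rintro ⟨y, hy⟩
    exact ((step_octopus hx).1 hy).1
  · intro h
    have := (step_octopus hx).2 ⟨h, rfl⟩
    exact ⟨⟨_, (edge x.2 this).1⟩, this⟩

theorem treeOK {x : {x // L.Valid x}} (hx : x.1.2.2 ≠ 0) : L.gadgetGraph.TreeOK x := by
  have hs : ∀ {a : HalfKind} {x y : {x // L.Valid x}}, x.1.2.2 ≠ 0 →
      L.gadgetGraph.step a x y → L.Can a x.1 ∧ y.1 = L.dest a x.1 :=
    fun hx h => (step_octopus hx).1 h
  have hs' : ∀ {a : HalfKind} {x y : {x // L.Valid x}}, x.1.2.2 ≠ 0 →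
      L.Can a x.1 ∧ y.1 = L.dest a x.1 → L.gadgetGraph.step a x y :=
    fun hx h => (step_octopus hx).2 h
  obtain ⟨⟨v, t, k⟩, hv⟩ := x
  have hk : k ≠ 0 := hx
  obtain ⟨e, he, hpe⟩ := L.exists_hgt v t
  constructor
  · intro a w w' h h'
    exact Subtype.ext ((hs hx h).2.trans (hs hx h').2.symm)
  · rw [has_iff hx, has_iff hx]; rfl
  · rintro ⟨x, hxv⟩ ⟨y, hyv⟩ h h'
    obtain ⟨-, rfl⟩ := hs hx h
    obtain ⟨-, rfl⟩ := hs hx h'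
    refine hs' (by simp only [dest]; omega) ⟨not_isTwoPow_two_mul_add_one hk, rfl⟩
  · rintro ⟨w, hwv⟩ h
    obtain ⟨hc, rfl⟩ := hs hx h
    rw [has_iff hx, has_iff (by simp only [dest]; omega)]
    simp only [Can, dest] at hc ⊢
    have : k + 1 ≠ 2 ^ e := fun h => hc (h ▸ isTwoPow_pow _)
    omega
  · rintro ⟨w, hwv⟩ ⟨y, hyv⟩ ⟨z, hzv⟩ h h' h''
    obtain ⟨hc, rfl⟩ := hs hx h
    obtain ⟨-, rfl⟩ := hs hx h'
    obtain ⟨-, rfl⟩ := hs (by simp only [dest]; omega) h''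
    refine hs' (by simp only [dest]; omega) ⟨fun h => hc (IsTwoPow.of_two_mul ?_), ?_⟩
    · simp only [dest] at h ⊢; convert h using 1; ring
    · simp only [dest, Prod.mk.injEq, true_and]; omega
  · rintro ⟨y, hyv⟩ h h'
    obtain ⟨-, rfl⟩ := hs hx h'
    rw [has_iff hx] at h
    rw [has_iff (by simp only [dest]; omega)]
    simp only [Can, dest, not_not] at h ⊢
    convert h.two_mul using 1; ring
  · rintro ⟨y, hyv⟩ h h'
    obtain ⟨-, rfl⟩ := hs hx h'
    rw [has_iff hx] at h
    rw [has_iff (by simp only [dest]; omega)]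
    simp only [Can, dest, not_not] at h ⊢
    exact h.two_mul
  · intro h
    rw [has_iff hx] at h ⊢
    rw [has_iff hx]
    simp only [Can, not_not] at h ⊢
    obtain rfl : k = 1 := by omega
    exact ⟨isTwoPow_one, isTwoPow_pow 1⟩

theorem locallyOK (x : {x // L.Valid x}) : L.gadgetGraph.LocallyOK x := by
  have hedge : ∀ a w, L.gadgetGraph.step a x w →
      ∃ b, L.gadgetGraph.step b w x ∧ EdgeOK (L.gadgetGraph.kind x) a b (L.gadgetGraph.kind w) :=
    fun a w h => (edge x.2 h).2
  by_cases hx : x.1.2.2 = 0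
  · have : L.gadgetGraph.kind x = .inter := by simp [gadgetGraph, kind, hx]
    constructor <;> simp_all
  · obtain ⟨⟨v, t, k⟩, hv⟩ := x
    obtain ⟨e, he, hpe⟩ := L.exists_hgt v t
    have hk : k ≠ 0 := hx
    have hkind : L.gadgetGraph.kind ⟨(v, t, k), hv⟩ = if t = 0 then .head else .port :=
      kind_octopus hk
    refine ⟨hedge, fun _ => treeOK hx, fun h => ?_, fun h => ?_, fun h => ?_, fun h => ?_⟩
    all_goals
      rw [hkind] at h
      simp only [has_iff hx, Can]
    · have : t = 0 := by by_contra h'; simp [h'] at h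
      subst this
      simp only [hgt, pow_succ, true_and]
      omega
    · exact fun h => ⟨h.1, h.2.1⟩
    · have : t ≠ 0 := by rintro rfl; simp at h
      omega
    · have : t ≠ 0 := by rintro rfl; simp at h
      obtain ⟨i, rfl⟩ := Nat.exists_eq_succ_of_ne_zero this
      obtain ⟨-, -, -, hlt⟩ := hv.octopus hk
      simp only [hgt] at he hpe hlt ⊢
      rw [hpe] at hlt ⊢
      rw [he, Nat.add_sub_cancel, not_not]
      constructor
      · rintro ⟨-, rfl⟩
        exact ⟨by omega, isTwoPow_pow _⟩
      · rintro ⟨h1, h2⟩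
        refine ⟨this, ?_⟩
        by_contra h3
        exact not_isTwoPow_of_lt (e := e) (by omega) (by rw [pow_succ]; omega) h2

end Layout

/-! ### Port numbers, finiteness and the network of an octopus graph -/

namespace Layout

variable {V : Type} (L : Layout V)

open Classical in
/-- The labels of the half-edges of `x`, in the order of the port numbers. -/
noncomputable def labels (x : V × ℕ × ℕ) : List HalfKind :=
  if x.2.2 = 0 then List.replicate (L.deg x.1) .inward else
    [.left, .right, .parent, .childL, .childR, .portA, .portB, .up, .outward, .inward].filter
      fun a => L.Can a x

open Classical in
/-- The port number at `x` of the edge to `y`. -/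
noncomputable def portNum (x y : V × ℕ × ℕ) : ℕ :=
  if x.2.2 = 0 then L.back y.1 (y.2.1 - 1) else (L.labels x).findIdx fun a => L.step a x y

variable {L}

theorem mem_labels {x : V × ℕ × ℕ} (hx : x.2.2 ≠ 0) {a : HalfKind} :
    a ∈ L.labels x ↔ L.Can a x := by
  rw [labels, if_neg hx, List.mem_filter]
  cases a <;> simp

theorem nodup_labels {x : V × ℕ × ℕ} (hx : x.2.2 ≠ 0) : (L.labels x).Nodup := by
  rw [labels, if_neg hx]
  exact List.Nodup.filter _ (by simp)

theorem step_label_unique {a b : HalfKind} {x y : V × ℕ × ℕ} (ha : L.step a x y)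
    (hb : L.step b x y) : a = b := by
  by_cases hx : x.2.2 = 0
  · rw [step_inter hx] at ha hb
    rw [ha.1, hb.1]
  · rw [step_octopus hx] at ha hb
    exact dest_injective hx ha.1 hb.1 (ha.2.symm.trans hb.2)

theorem portNum_inDest {b : V} {t : ℕ} {j : ℕ} (hj : j < L.deg b) :
    L.portNum (b, t, 0) (L.inDest b j) = j := by
  rw [portNum, if_pos rfl]
  exact L.back_back b j hj

/-- Consistency of ports and labels; it makes the labeled graph of the network coincide with
`L.gadgetGraph`. -/
theorem labels_portNum {a : HalfKind} {x y : V × ℕ × ℕ} (h : L.step a x y) :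
    (L.labels x)[L.portNum x y]? = some a := by
  classical
  by_cases hx : x.2.2 = 0
  · obtain ⟨rfl, j, hj, rfl⟩ := (step_inter hx).1 h
    obtain ⟨v, t, k⟩ := x
    obtain rfl : k = 0 := hx
    dsimp only at hj ⊢
    rw [portNum_inDest hj, labels, if_pos rfl, List.getElem?_replicate, if_pos hj]
  · have hmem : a ∈ L.labels x := (mem_labels hx).2 ((step_octopus hx).1 h).1
    rw [portNum, if_neg hx]
    have hlt : (L.labels x).findIdx (fun a => L.step a x y) < (L.labels x).length :=
      List.findIdx_lt_length_of_exists ⟨a, hmem, by simpa using h⟩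
    rw [List.getElem?_eq_getElem hlt]
    have := List.findIdx_getElem (w := hlt)
    exact congrArg some (step_label_unique (by simpa using this) h)

theorem portNum_bijOn (x : {x // L.Valid x}) :
    Set.BijOn (fun y : {x // L.Valid x} => L.portNum x.1 y.1) {y | ∃ a, L.step a x.1 y.1}
      (Set.Iio (L.labels x.1).length) := by
  have hmaps : ∀ y, (∃ a, L.step a x.1 y) → L.portNum x.1 y < (L.labels x.1).length := by
    rintro y ⟨a, ha⟩
    exact (List.getElem?_eq_some_iff.1 (labels_portNum ha)).1
  refine ⟨fun y hy => hmaps _ hy, ?_, ?_⟩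
  · rintro y ⟨a, ha⟩ z ⟨b, hb⟩ h
    dsimp only at h
    refine Subtype.ext ?_
    by_cases hx : x.1.2.2 = 0
    · obtain ⟨⟨v, t, k⟩, hv⟩ := x
      obtain rfl : k = 0 := hx
      obtain ⟨-, j, hj, hy⟩ := (step_inter rfl).1 ha
      obtain ⟨-, j', hj', hz⟩ := (step_inter rfl).1 hb
      dsimp only at hj hj' hy hz h
      rw [hy, hz, portNum_inDest hj, portNum_inDest hj'] at h
      rw [hy, hz, h]
    · have h1 := labels_portNum ha
      rw [h, labels_portNum hb] at h1
      obtain rfl := Option.some.inj h1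
      rw [step_octopus hx] at ha hb
      exact ha.2.trans hb.2.symm
  · intro i hi
    by_cases hx : x.1.2.2 = 0
    · obtain ⟨⟨v, t, k⟩, hv⟩ := x
      obtain rfl : k = 0 := hx
      have hi : i < L.deg v := by simpa [labels] using hi
      have hs : L.step .inward (v, t, 0) (L.inDest v i) := (step_inter rfl).2 ⟨rfl, i, hi, rfl⟩
      exact ⟨⟨_, (edge hv hs).1⟩, ⟨_, hs⟩, portNum_inDest hi⟩
    · have hi : i < (L.labels x.1).length := hi
      have hs : L.step (L.labels x.1)[i] x.1 (L.dest (L.labels x.1)[i] x.1) :=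
        (step_octopus hx).2 ⟨(mem_labels hx).1 (List.getElem_mem hi), rfl⟩
      refine ⟨⟨_, (edge x.2 hs).1⟩, ⟨_, hs⟩, ?_⟩
      have h1 := labels_portNum hs
      rw [List.getElem?_eq_some_iff] at h1
      exact ((nodup_labels hx).getElem_inj_iff).1 h1.2

theorem finite_valid (v : V) : {tk : ℕ × ℕ | L.Valid (v, tk)}.Finite := by
  refine ((Set.finite_Iic (L.deg v)).prod
    (Set.finite_Iio (2 ^ L.hgt v 0 + 2 ^ L.hgt v 1))).subset ?_
  rintro ⟨t, k⟩ h
  rcases h with ⟨-, -, h1, -, h2⟩ | ⟨-, h1, h2⟩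
  · refine ⟨h1, ?_⟩
    cases t
    · exact lt_of_lt_of_le h2 (Nat.le_add_right _ _)
    · exact lt_of_lt_of_le h2 (Nat.le_add_left _ _)
  · dsimp only at h1 h2
    subst h1 h2
    exact ⟨Nat.zero_le _, Set.mem_Iio.2 (by positivity)⟩

instance [Finite V] : Finite {x // L.Valid x} := by
  have (v : V) : Finite {tk : ℕ × ℕ // L.Valid (v, tk)} := finite_valid v
  exact Finite.of_equiv _ (Equiv.subtypeProdEquivSigmaSubtype fun v tk => L.Valid (v, tk)).symm

theorem card_valid [Fintype V] :
    Nat.card {x // L.Valid x} = ∑ v, {tk : ℕ × ℕ | L.Valid (v, tk)}.ncard := by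
  have (v : V) : Finite {tk : ℕ × ℕ // L.Valid (v, tk)} := finite_valid v
  rw [Nat.card_congr (Equiv.subtypeProdEquivSigmaSubtype fun v tk => L.Valid (v, tk)),
    Nat.card_sigma]
  rfl

variable (L) in
/-- The network with underlying labeled graph `L.gadgetGraph` and the given identifiers. -/
noncomputable def network [Finite V] (c : ℕ) (id : {x // L.Valid x} → ℕ)
    (hid : Function.Injective id)
    (hmem : ∀ x, id x ∈ Set.Icc 1 (Nat.card {x // L.Valid x} ^ c)) :
    Network c NodeKind HalfKind where
  V := {x // L.Valid x}
  fintypeV := Fintype.ofFinite _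
  graph :=
    { Adj := fun x y => ∃ a, L.step a x.1 y.1
      symm := ⟨fun x _ ⟨_, ha⟩ => let ⟨b, hb, _⟩ := (edge x.2 ha).2; ⟨b, hb⟩⟩
      loopless := ⟨fun _ ⟨_, ha⟩ => not_step_self ha⟩ }
  ident := id
  ident_injective := hid
  ident_mem := by
    intro v
    rw [← @Nat.card_eq_fintype_card _ (_)]
    exact hmem v
  label x := kind x.1
  halfLabels x := L.labels x.1
  port x y := L.portNum x.1 y.1
  port_bijOn := portNum_bijOn

section

variable [Finite V] {c : ℕ} {id : {x // L.Valid x} → ℕ} {hid : Function.Injective id}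
  {hmem : ∀ x, id x ∈ Set.Icc 1 (Nat.card {x // L.Valid x} ^ c)}

theorem size_network : (L.network c id hid hmem).size = Nat.card {x // L.Valid x} :=
  (@Nat.card_eq_fintype_card _ (_)).symm

theorem gadgetGraph_network : (L.network c id hid hmem).gadgetGraph = L.gadgetGraph := by
  refine congrArg (GadgetGraph.mk _) ?_
  funext a x y
  refine propext ⟨fun ⟨⟨b, hb⟩, h⟩ => ?_, fun h => ⟨⟨a, h⟩, labels_portNum h⟩⟩
  have h' : some b = some a := (labels_portNum hb).symm.trans h
  obtain rfl := Option.some.inj h'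
  exact hb

theorem network_mem_promise {S : Type} (P : LinearizableProblem S)
    (hL : ∀ v, ¬ L.white v → L.deg v ∈ P.sizes) :
    L.network c id hid hmem ∈ (P.promise c).inputs := by
  refine ⟨fun u => ?_, fun (x : {x // L.Valid x}) hx => ?_⟩
  · rw [gadgetGraph_network]
    exact locallyOK u
  · suffices h : (L.labels x.1).length ∈ P.sizes from
      (Network.degree_eq_length (L.network c id hid hmem) x).symm ▸ h
    obtain ⟨⟨v, t, k⟩, hv⟩ := x
    have hk : k = 0 := by
      by_contra hk
      exact kind_octopus_ne hk hx
    subst hk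
    simpa [labels] using hL v hv.inter.1

end

/-! ### Disjoint unions and stars -/

/-- The disjoint union of two layouts. -/
def sum {V' : Type} (L : Layout V) (L' : Layout V') : Layout (V ⊕ V') where
  white := Sum.elim L.white L'.white
  deg := Sum.elim L.deg L'.deg
  nb := Sum.elim (fun v i => .inl (L.nb v i)) (fun v i => .inr (L'.nb v i))
  back := Sum.elim L.back L'.back
  ht := Sum.elim L.ht L'.ht
  ht_pos := Sum.rec L.ht_pos L'.ht_pos
  white_nb := Sum.rec L.white_nb L'.white_nb
  back_lt := Sum.rec L.back_lt L'.back_lt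
  nb_back := Sum.rec (fun v i h => congrArg Sum.inl (L.nb_back v i h))
    (fun v i h => congrArg Sum.inr (L'.nb_back v i h))
  back_back := Sum.rec L.back_back L'.back_back

section

variable {V' : Type} {L' : Layout V'}

theorem hgt_sum_inl (v : V) (t : ℕ) : (L.sum L').hgt (.inl v) t = L.hgt v t := by
  cases t <;> rfl

theorem hgt_sum_inr (v : V') (t : ℕ) : (L.sum L').hgt (.inr v) t = L'.hgt v t := by
  cases t <;> rfl

theorem valid_sum_inl {v : V} {t k : ℕ} :
    (L.sum L').Valid (.inl v, t, k) ↔ L.Valid (v, t, k) := by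
  simp only [Valid, hgt_sum_inl]; rfl

theorem valid_sum_inr {v : V'} {t k : ℕ} :
    (L.sum L').Valid (.inr v, t, k) ↔ L'.Valid (v, t, k) := by
  simp only [Valid, hgt_sum_inr]; rfl

theorem card_valid_sum [Fintype V] [Fintype V'] :
    Nat.card {x // (L.sum L').Valid x} =
      Nat.card {x // L.Valid x} + Nat.card {x // L'.Valid x} := by
  rw [card_valid, card_valid, card_valid, Fintype.sum_sum_type]
  refine congrArg₂ (· + ·) ?_ ?_
  · exact Finset.sum_congr rfl fun v _ => congrArg _ (Set.ext fun _ => valid_sum_inl)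
  · exact Finset.sum_congr rfl fun v _ => congrArg _ (Set.ext fun _ => valid_sum_inr)

end

/-- A disjoint union of `m` stars with `d` white leaves each. The first `k` white nodes have
port-gadgets of height `2`, the others of height `1`. -/
def stars (d m k : ℕ) : Layout (Fin m × Option (Fin d)) where
  white x := x.2.isSome
  deg x := x.2.elim d fun _ => 1
  nb x j := (x.1, x.2.elim (if h : j < d then some ⟨j, h⟩ else none) fun _ => none)
  back x _ := x.2.elim 0 fun i => i
  ht x := x.2.elim 1 fun i => if (finProdFinEquiv (x.1, i) : ℕ) < k then 2 else 1
  ht_pos := by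
    rintro ⟨a, _ | b⟩
    · simp
    · simp only [Option.elim_some]; split <;> simp
  white_nb := by
    rintro ⟨a, _ | b⟩ i hi
    · simp only [Option.elim_none] at hi; simp [hi]
    · simp
  back_lt := by
    rintro ⟨a, _ | b⟩ i hi
    · simp only [Option.elim_none] at hi; simp [hi]
    · simp
  nb_back := by
    rintro ⟨a, _ | b⟩ i hi
    · simp only [Option.elim_none] at hi; simp [hi]
    · simp
  back_back := by
    rintro ⟨a, _ | b⟩ i hi
    · simp only [Option.elim_none] at hi; simp [hi]
    · simp only [Option.elim_some, Nat.lt_one_iff] at hi; simp [hi]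

theorem ncard_valid_inter {v : V} (hv : ¬ L.white v) :
    {tk : ℕ × ℕ | L.Valid (v, tk)}.ncard = 1 := by
  rw [Set.ncard_eq_one]
  refine ⟨(0, 0), Set.ext fun ⟨t, k⟩ => ?_⟩
  simp [Valid, hv]

/-- The head-gadget is a single node and the only port-gadget has `2 ^ ht - 1` nodes; the index `0`,
which no gadget node uses, stands for the head. -/
theorem ncard_valid_leaf {v : V} (hv : L.white v) (hd : L.deg v = 1) :
    {tk : ℕ × ℕ | L.Valid (v, tk)}.ncard = 2 ^ L.ht v := by
  have : {tk : ℕ × ℕ | L.Valid (v, tk)} =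
      (((Finset.range (2 ^ L.ht v)).image fun k => if k = 0 then (0, 1) else (1, k) :
        Finset (ℕ × ℕ)) : Set (ℕ × ℕ)) := by
    ext ⟨t, k⟩
    have hlog : 2 ^ L.hgt v 0 = 2 := by simp [hgt, hd]
    have hp : 0 < 2 ^ L.ht v := by positivity
    simp only [Set.mem_ofPred_eq, Finset.coe_image, Set.mem_image, Finset.coe_range, Set.mem_Iio,
      Valid, hv, hd, not_true_eq_false, false_and, or_false, true_and, zero_lt_one]
    constructor
    · rintro ⟨h1, h2, h3⟩
      rcases t with _ | t
      · rw [hlog] at h3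
        exact ⟨0, hp, by simp; omega⟩
      · obtain rfl : t = 0 := by omega
        exact ⟨k, h3, by simp [h2]⟩
    · rintro ⟨j, hj, he⟩
      split_ifs at he with h0
      · obtain ⟨rfl, rfl⟩ := Prod.mk.inj he
        rw [hlog]; simp
      · obtain ⟨rfl, rfl⟩ := Prod.mk.inj he
        exact ⟨le_rfl, h0, hj⟩
  rw [this, Set.ncard_coe_finset, Finset.card_image_of_injOn, Finset.card_range]
  intro a _ b _ h
  dsimp only at h
  split_ifs at h <;> simp_all

theorem card_valid_stars {d m k : ℕ} (hk : k ≤ m * d) :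
    Nat.card {x // (stars d m k).Valid x} = m + 2 * (m * d) + 2 * k := by
  have h1 : ∀ a, {tk : ℕ × ℕ | (stars d m k).Valid ((a, none), tk)}.ncard = 1 :=
    fun a => ncard_valid_inter (by simp [stars])
  have h2 : ∀ a b, {tk : ℕ × ℕ | (stars d m k).Valid ((a, some b), tk)}.ncard =
      (2 + if (finProdFinEquiv (a, b) : ℕ) < k then 2 else 0) := fun a b => by
    rw [ncard_valid_leaf (by simp [stars]) (by simp [stars])]
    simp only [stars, Option.elim_some]
    split_ifs <;> simp
  rw [card_valid, Fintype.sum_prod_type]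
  simp only [Fintype.sum_option, h1, h2]
  rw [Finset.sum_add_distrib, ← Fintype.sum_prod_type',
    finProdFinEquiv.sum_comp (fun i : Fin (m * d) => 2 + if (i : ℕ) < k then 2 else 0),
    Finset.sum_add_distrib, Fin.sum_univ_eq_sum_range (fun i => if i < k then 2 else 0),
    ← Finset.sum_filter]
  have : (Finset.range (m * d)).filter (· < k) = Finset.range k := by
    ext i; simp; omega
  rw [this]
  simp
  ring

/-- A star with all port-gadgets of height `1` has `2 * d + 1` nodes, and each port-gadget raised to
height `2` adds two more. Take for `m` the quotient of `R` by `2 * d + 1`, or one less, so as to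
match the parity of `R`. As the quotient is at least `3`, there are always enough port-gadgets to
absorb the remainder. -/
theorem exists_stars {d R : ℕ} (hR : 6 * d + 3 ≤ R) :
    ∃ m k, k ≤ m * d ∧ m + 2 * (m * d) + 2 * k = R := by
  have h1 := Nat.div_add_mod R (2 * d + 1)
  have h2 := Nat.mod_lt R (show 2 * d + 1 > 0 by omega)
  have h3 : 3 ≤ R / (2 * d + 1) := by
    rw [Nat.le_div_iff_mul_le (by omega)]; omega
  generalize R / (2 * d + 1) = s at h1 h3
  generalize R % (2 * d + 1) = r at h1 h2
  obtain ⟨s, rfl⟩ : ∃ t, s = t + 3 := ⟨s - 3, by omega⟩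
  have e1 : (2 * d + 1) * (s + 3) = 2 * (s * d) + s + 6 * d + 3 := by ring
  rw [e1] at h1
  by_cases hp : (R + s) % 2 = 1
  · refine ⟨s + 3, (R - (2 * (s * d) + s + 6 * d + 3)) / 2, ?_, ?_⟩
    · rw [show (s + 3) * d = s * d + 3 * d by ring]; omega
    · rw [show (s + 3) * d = s * d + 3 * d by ring]; omega
  · refine ⟨s + 2, (R - (2 * (s * d) + s + 4 * d + 2)) / 2, ?_, ?_⟩
    · rw [show (s + 2) * d = s * d + 2 * d by ring]; omega
    · rw [show (s + 2) * d = s * d + 2 * d by ring]; omega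

end Layout

/-- Used to give identifiers to the padding stars while keeping the prescribed identifiers of the
other nodes. -/
theorem exists_injective_extension {α : Type*} [Finite α] {s : Set α} {f : α → ℕ} {B : ℕ}
    (hf : Set.InjOn f s) (hs : Set.MapsTo f s (Set.Icc 1 B)) (hB : Nat.card α ≤ B) :
    ∃ g : α → ℕ, Function.Injective g ∧ (∀ x, g x ∈ Set.Icc 1 B) ∧ Set.EqOn g f s := by
  classical
  have := Fintype.ofFinite α
  obtain ⟨t, hst, htB, ht⟩ := Finset.exists_subsuperset_card_eq (s := s.toFinset.image f)
    (t := Finset.Icc 1 B) (n := Fintype.card α)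
    (fun x hx => by
      obtain ⟨a, ha, rfl⟩ := Finset.mem_image.1 hx
      exact Finset.mem_Icc.2 (hs (Set.mem_toFinset.1 ha)))
    (Finset.card_image_le.trans (Finset.card_le_univ _))
    (by simpa [Nat.card_eq_fintype_card] using hB)
  obtain ⟨g, hg⟩ := Finset.exists_equiv_extend_of_card_eq ht.symm hst (by simpa using hf)
  refine ⟨fun x => g x, fun x y h => g.injective (Subtype.ext h),
    fun x => Finset.mem_Icc.1 (htB (g x).2), fun x hx => hg x (Set.mem_toFinset.2 hx)⟩

/-! ### Reading a solution of the linearizable problem off a promise solution -/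

namespace Layout

variable {V : Type} {L : Layout V} {S : Type} {P : LinearizableProblem S}

theorem kind_head {v : V} {k : ℕ} (hk : k ≠ 0) : kind (v, 0, k) = .head := by
  simp [kind, hk]

theorem kind_port {v : V} {i k : ℕ} (hk : k ≠ 0) : kind (v, i + 1, k) = .port := by
  simp [kind, hk]

theorem valid_root {v : V} (hv : L.white v) {i : ℕ} (hi : i < L.deg v) :
    L.Valid (v, i + 1, 1) :=
  valid_octopus hv (by omega) hi one_ne_zero (Nat.one_lt_two_pow (L.hgt_pos _ _).ne')

open Classical in
variable (L) in
/-- The labels of the port-gadgets of the white node `v`, from left to right. -/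
noncomputable def decode (y : {x // L.Valid x} → Option S) (v : V) : List S :=
  if L.white v then (List.range (L.deg v)).filterMap fun i =>
    if h : L.Valid (v, i + 1, 1) then y ⟨_, h⟩ else none
  else []

theorem leafOf_bounds {d i : ℕ} (hi : i < d) :
    2 ^ Nat.log 2 d ≤ leafOf d i ∧ leafOf d i < 2 * 2 ^ Nat.log 2 d := by
  have h1 := pow_log_le (show 0 < d by omega)
  have h2 := lt_two_mul_pow_log d
  unfold leafOf
  omega

theorem decode_of_deg_eq_zero {y : {x // L.Valid x} → Option S} {v : V} (h : L.deg v = 0) : L.decode y v = [] := by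
  simp [decode, h]

theorem valid_leafOf {v : V} (hv : L.white v) {i : ℕ} (hi : i < L.deg v) :
    L.Valid (v, 0, leafOf (L.deg v) i) := by
  refine valid_octopus hv (by omega) (Nat.zero_le _) (leafOf_ne_zero _ _) ?_
  have := (leafOf_bounds hi).2
  simp only [hgt, pow_succ]
  omega

theorem step_portA {v : V} {i : ℕ} (hi : i < L.deg v)
    (h : ¬ (i < 2 * (L.deg v - 2 ^ Nat.log 2 (L.deg v)) ∧ i % 2 = 1)) :
    L.step .portA (v, 0, leafOf (L.deg v) i) (v, i + 1, 1) := by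
  have h1 := pow_log_le (show 0 < L.deg v by omega)
  have h2 := lt_two_mul_pow_log (L.deg v)
  refine (step_octopus (leafOf_ne_zero _ _)).2 ⟨⟨rfl, (leafOf_bounds hi).1⟩, ?_⟩
  simp only [dest, leafOf, Prod.mk.injEq, true_and, and_true]
  omega

theorem step_portB {v : V} {i : ℕ} (hi : i < L.deg v)
    (h : i < 2 * (L.deg v - 2 ^ Nat.log 2 (L.deg v)) ∧ i % 2 = 1) :
    L.step .portB (v, 0, leafOf (L.deg v) i) (v, i + 1, 1) := by
  have h1 := pow_log_le (show 0 < L.deg v by omega)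
  have h2 := lt_two_mul_pow_log (L.deg v)
  refine (step_octopus (leafOf_ne_zero _ _)).2 ⟨⟨rfl, (leafOf_bounds hi).1, ?_⟩, ?_⟩
  · simp only [leafOf]; omega
  · simp only [dest, leafOf, Prod.mk.injEq, true_and, and_true]; omega

theorem lastPort_root {v : V} (hv : L.white v) {i : ℕ} (hi : i < L.deg v)
    (h : i < 2 * (L.deg v - 2 ^ Nat.log 2 (L.deg v)) → i % 2 = 1) :
    L.gadgetGraph.LastPort ⟨_, valid_leafOf hv hi⟩ ⟨_, valid_root hv hi⟩ := by
  by_cases h2 : i < 2 * (L.deg v - 2 ^ Nat.log 2 (L.deg v))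
  · exact .inl (step_portB hi ⟨h2, h h2⟩)
  · refine .inr ⟨step_portA hi fun h3 => h2 h3.1, ?_⟩
    rw [has_iff (leafOf_ne_zero _ _)]
    rintro ⟨-, -, h3⟩
    simp only [leafOf] at h3
    omega

/-- The gadget after the first one of a two-port leaf hangs from the same leaf. In every other case
the index of the leaf grows by one, so the next gadget is the first one of the right neighbor leaf.
-/
theorem nextPort_root {v : V} (hv : L.white v) {i : ℕ} (hi : i + 1 < L.deg v) :
    L.gadgetGraph.NextPort ⟨_, valid_root hv (Nat.lt_of_succ_lt hi)⟩ ⟨_, valid_root hv hi⟩ := by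
  have hi' := Nat.lt_of_succ_lt hi
  have hd := lt_two_mul_pow_log (L.deg v)
  refine ⟨⟨_, valid_leafOf hv hi'⟩, ?_⟩
  by_cases h : i < 2 * (L.deg v - 2 ^ Nat.log 2 (L.deg v)) ∧ i % 2 = 0
  · refine .inl ⟨step_portA hi' (by omega), ?_⟩
    have : leafOf (L.deg v) i = leafOf (L.deg v) (i + 1) := by
      simp only [leafOf]; omega
    simp only [this]
    exact step_portB hi (by omega)
  · refine .inr ⟨⟨_, valid_leafOf hv hi⟩, ?_, lastPort_root hv hi' (by omega),
      step_portA hi (by omega)⟩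
    have h1 : leafOf (L.deg v) (i + 1) = leafOf (L.deg v) i + 1 := by
      simp only [leafOf]; omega
    have h2 := leafOf_bounds hi
    have h3 := leafOf_bounds hi'
    refine (step_octopus (leafOf_ne_zero _ _)).2 ⟨?_, by simp only [dest, h1]⟩
    exact not_isTwoPow_of_lt (e := Nat.log 2 (L.deg v)) (show _ < leafOf _ _ + 1 by omega)
      (show leafOf _ _ + 1 < _ by rw [pow_succ]; omega)

section

variable {y : {x // L.Valid x} → Option S} [Finite V]

/-- Climb to the root along `k ↦ k / 2`. This lets the black constraint, which reads the labels of
left-most leaves, be expressed by the labels of roots. -/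
theorem label_eq_root (hy : L.gadgetGraph.PromiseSolution P y) {v : V} {i k : ℕ}
    (h : L.Valid (v, i + 1, k)) (h1 : L.Valid (v, i + 1, 1)) : y ⟨_, h⟩ = y ⟨_, h1⟩ := by
  induction k using Nat.strong_induction_on with
  | _ k ih =>
  have hk : k ≠ 0 := by rintro rfl; exact absurd h.inter.2 (by omega)
  by_cases hk1 : k = 1
  · subst hk1; rfl
  have hs : L.step .parent (v, i + 1, k) (v, i + 1, k / 2) :=
    (step_octopus hk).2 ⟨show 2 ≤ k by omega, rfl⟩
  have hv := (edge h hs).1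
  rw [← ih (k / 2) (by omega) hv]
  refine hy.const .parent _ _ ?_ ?_ hs
  · exact kind_port hk
  · exact kind_port (by omega)

theorem exists_decode (hy : L.gadgetGraph.PromiseSolution P y) {v : V} (hv : L.white v)
    (hd : 0 < L.deg v) : ∃ f : ℕ → S, L.decode y v = (List.range (L.deg v)).map f ∧
      ∀ i (h : L.Valid (v, i + 1, 1)), i < L.deg v → y ⟨_, h⟩ = some (f i) := by
  have h1 : ∀ i (hi : i < L.deg v), ∃ s, y ⟨_, valid_root hv hi⟩ = some s := fun i hi =>
    hy.lab _ (kind_port (v := v) (i := i) one_ne_zero)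
  choose f hf using h1
  refine ⟨fun i => if hi : i < L.deg v then f i hi else f 0 hd, ?_, fun i h hi => ?_⟩
  · rw [decode, if_pos hv, ← List.filterMap_eq_map]
    refine List.filterMap_congr fun i hi => ?_
    have hi := List.mem_range.1 hi
    rw [dif_pos (valid_root hv hi), hf i hi]
    simp [hi]
  · simp only [dif_pos hi]
    exact hf i hi

theorem length_decode (hy : L.gadgetGraph.PromiseSolution P y) {v : V} (hv : L.white v) :
    (L.decode y v).length = L.deg v := by
  rcases Nat.eq_zero_or_pos (L.deg v) with hd | hd
  · rw [decode_of_deg_eq_zero hd, hd]; rfl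
  · obtain ⟨f, hf, -⟩ := exists_decode hy hv hd
    simp [hf]

theorem decode_head (hy : L.gadgetGraph.PromiseSolution P y) {v : V} (hv : L.white v) :
    ∀ s ∈ (L.decode y v).head?, s ∈ P.first := by
  rcases Nat.eq_zero_or_pos (L.deg v) with hd | hd
  · simp [decode_of_deg_eq_zero hd]
  obtain ⟨f, hf, hf'⟩ := exists_decode hy hv hd
  have hleft : ¬ L.gadgetGraph.Has .left ⟨_, valid_leafOf hv hd⟩ := by
    rw [has_iff (leafOf_ne_zero _ _)]
    simp only [Can, leafOf, not_not]
    convert isTwoPow_pow (Nat.log 2 (L.deg v)) using 1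
    simp
  obtain ⟨s, hs, h⟩ := hy.first ⟨_, valid_leafOf hv hd⟩ ⟨_, valid_root hv hd⟩
    (kind_head (v := v) (leafOf_ne_zero _ _)) hleft (step_portA hd (by omega))
  rw [hf' 0 _ hd, Option.some.injEq] at h
  obtain ⟨e, he⟩ := Nat.exists_eq_succ_of_ne_zero hd.ne'
  rw [hf, he, List.range_succ_eq_map]
  simpa [h] using hs

theorem decode_getLast (hy : L.gadgetGraph.PromiseSolution P y) {v : V} (hv : L.white v) :
    ∀ s ∈ (L.decode y v).getLast?, s ∈ P.last := by
  rcases Nat.eq_zero_or_pos (L.deg v) with hd | hd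
  · simp [decode_of_deg_eq_zero hd]
  obtain ⟨f, hf, hf'⟩ := exists_decode hy hv hd
  obtain ⟨e, he⟩ := Nat.exists_eq_succ_of_ne_zero hd.ne'
  have hi : e < L.deg v := by omega
  have h1 := pow_log_le hd
  have h2 := lt_two_mul_pow_log (L.deg v)
  have hright : ¬ L.gadgetGraph.Has .right ⟨_, valid_leafOf hv hi⟩ := by
    rw [has_iff (leafOf_ne_zero _ _)]
    simp only [Can, leafOf, not_not]
    convert isTwoPow_pow (Nat.log 2 (L.deg v) + 1) using 1
    rw [pow_succ]
    omega
  obtain ⟨s, hs, h⟩ := hy.last ⟨_, valid_leafOf hv hi⟩ ⟨_, valid_root hv hi⟩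
    (kind_head (v := v) (leafOf_ne_zero _ _)) hright
    (lastPort_root hv hi (by omega))
  rw [hf' e _ hi, Option.some.injEq] at h
  rw [hf, he, List.range_succ]
  simpa [h] using hs

theorem decode_isChain (hy : L.gadgetGraph.PromiseSolution P y) {v : V} (hv : L.white v) :
    (L.decode y v).IsChain fun s t => (s, t) ∈ P.pairs := by
  rcases Nat.eq_zero_or_pos (L.deg v) with hd | hd
  · simp [decode_of_deg_eq_zero hd]
  obtain ⟨f, hf, hf'⟩ := exists_decode hy hv hd
  rw [hf, List.isChain_iff_getElem]
  intro i hi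
  have hi : i + 1 < L.deg v := by simpa using hi
  obtain ⟨s, t, hst, hs, ht⟩ := hy.pairs _ _ (nextPort_root hv hi)
  rw [hf' i _ (by omega), Option.some.injEq] at hs
  rw [hf' (i + 1) _ hi, Option.some.injEq] at ht
  simpa [hs, ht] using hst

theorem decode_getElem? (hy : L.gadgetGraph.PromiseSolution P y) {v : V} (hv : L.white v) {i : ℕ}
    (hi : i < L.deg v) {k : ℕ} (h : L.Valid (v, i + 1, k)) :
    (L.decode y v)[i]? = y ⟨_, h⟩ := by
  obtain ⟨f, hf, hf'⟩ := exists_decode hy hv (by omega)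
  rw [label_eq_root hy h (valid_root hv hi), hf' i _ hi, hf]
  simp [hi]

/-- The multiset of the labels at a black node. -/
theorem decode_black (hy : L.gadgetGraph.PromiseSolution P y) {b : V} (hb : ¬ L.white b)
    (hD : L.deg b ∈ P.sizes) : ∃ m ∈ P.black, (Multiset.range (L.deg b)).map
      (fun j => (L.decode y (L.nb b j))[L.back b j]?) = m.map some := by
  classical
  -- The neighbors of the inter-octopus node, indexed by its ports; `back_back` recovers the port
  -- from the leaf.
  let F : Fin (L.deg b) → {x // L.Valid x} := fun j => ⟨_, valid_inDest hb j.2⟩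
  have hF : Function.Injective F := by
    intro i j h
    have h1 := congrArg Subtype.val h
    simp only [F, inDest, Prod.mk.injEq] at h1
    have h2 := L.back_back b i i.2
    rw [h1.1, show L.back b i = L.back b j by omega, L.back_back b j j.2] at h2
    exact Fin.ext h2.symm
  have hset : F '' Set.univ = {w | L.gadgetGraph.step .inward ⟨_, valid_inter hb⟩ w} := by
    ext w
    simp only [Set.image_univ, Set.mem_range, Set.mem_ofPred_eq]
    constructor
    · rintro ⟨j, rfl⟩
      exact (step_inter rfl).2 ⟨rfl, j, j.2, rfl⟩
    · intro h
      obtain ⟨-, j, hj, h⟩ := (step_inter rfl).1 h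
      exact ⟨⟨j, hj⟩, Subtype.ext h.symm⟩
  obtain ⟨m, hm, he⟩ := hy.black ⟨_, valid_inter hb⟩ (kind_inter (v := b) (t := 0)) (by
    rw [← hset, Set.ncard_image_of_injective _ hF]
    simpa [Set.ncard_univ] using hD)
  refine ⟨m, hm, ?_⟩
  rw [← he, Set.toFinset_image_val_map hF.injOn hset]
  have h1 : (Set.toFinite (Set.univ : Set (Fin (L.deg b)))).toFinset = Finset.univ := by
    ext; simp
  have h2 : Multiset.range (L.deg b) = (Finset.univ : Finset (Fin (L.deg b))).val.map (↑) := by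
    have := Fin.univ_val_map (n := L.deg b) (fun i => (i : ℕ))
    rw [this, List.ofFn_eq_map]
    simp [Multiset.range]
  rw [h1, h2, Multiset.map_map]
  refine Multiset.map_congr rfl fun j _ => ?_
  have hlt := L.back_lt b j j.2
  exact decode_getElem? hy ((L.white_nb b j j.2).2 hb) hlt _

end

end Layout

/-! ### The lift of an input of the linearizable problem -/

namespace Network

variable {c : ℕ} {X Y : Type}

open Classical in
/-- The neighbor of `v` at its port `i`. -/
noncomputable def nbr (N : Network c X Y) (v : N.V) (i : ℕ) : N.V :=
  if h : ∃ w, N.graph.Adj v w ∧ N.port v w = i then h.choose else v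

theorem nbr_spec (N : Network c X Y) {v : N.V} {i : ℕ} (hi : i < (N.halfLabels v).length) :
    N.graph.Adj v (N.nbr v i) ∧ N.port v (N.nbr v i) = i := by
  obtain ⟨w, hw, h⟩ := (N.port_bijOn v).surjOn hi
  have : ∃ w, N.graph.Adj v w ∧ N.port v w = i := ⟨w, hw, h⟩
  rw [nbr, dif_pos this]
  exact this.choose_spec

theorem nbr_port (N : Network c X Y) {v w : N.V} (h : N.graph.Adj v w) :
    N.nbr v (N.port v w) = w := by
  have := N.nbr_spec (N.port_lt h)
  exact (N.port_bijOn v).injOn this.1 h this.2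

theorem _root_.Color.eq_white_iff_of_ne {a b : Color} (h : a ≠ b) : a = .white ↔ ¬ b = .white := by
  cases a <;> cases b <;> simp_all

/-- The layout of a bipartite network, with port-gadgets of height `h`. -/
noncomputable def layout (N : Network c Color Unit)
    (hN : ∀ u w, N.graph.Adj u w → N.label u ≠ N.label w) (h : ℕ) (hh : 0 < h) : Layout N.V where
  white v := N.label v = .white
  deg v := (N.halfLabels v).length
  nb := N.nbr
  back v i := N.port (N.nbr v i) v
  ht _ := h
  ht_pos _ := hh
  white_nb v i hi := Color.eq_white_iff_of_ne (hN _ _ (N.nbr_spec hi).1.symm)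
  back_lt v i hi := N.port_lt (N.nbr_spec hi).1.symm
  nb_back v i hi := N.nbr_port (N.nbr_spec hi).1.symm
  back_back v i hi := by
    rw [N.nbr_port (N.nbr_spec hi).1.symm, (N.nbr_spec hi).2]

theorem decode_solution {S : Type} {P : LinearizableProblem S} {N : Network c Color Unit}
    (hNP : N ∈ (P.problem c).inputs) {h : ℕ} {hh : 0 < h} {V' : Type} [Finite V'] {L' : Layout V'}
    {y : {x // ((N.layout hNP.1 h hh).sum L').Valid x} → Option S}
    (hy : ((N.layout hNP.1 h hh).sum L').gadgetGraph.PromiseSolution P y) :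
    (P.problem c).Solution N fun v => ((N.layout hNP.1 h hh).sum L').decode y (.inl v) := by
  refine ⟨fun v hv => ⟨?_, ?_, ?_, ?_⟩, fun u hu => ⟨?_, ?_⟩⟩
  · rw [N.degree_eq_length]
    exact Layout.length_decode hy (v := .inl v) hv
  · exact Layout.decode_head hy (v := .inl v) hv
  · exact Layout.decode_getLast hy (v := .inl v) hv
  · exact Layout.decode_isChain hy (v := .inl v) hv
  · exact if_neg (show ¬ N.label u = .white by simp [hu])
  · have hD := hNP.2 u hu
    rw [N.degree_eq_length] at hD
    obtain ⟨m, hm, he⟩ := Layout.decode_black hy (b := .inl u)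
      (show ¬ N.label u = .white by simp [hu]) hD
    refine ⟨m, hm, he ▸ ?_⟩
    have hset : N.nbr u '' Set.Iio (N.halfLabels u).length = N.graph.neighborSet u := by
      ext w
      constructor
      · rintro ⟨i, hi, rfl⟩
        exact (N.nbr_spec hi).1
      · intro hw
        exact ⟨N.port u w, N.port_lt hw, N.nbr_port hw⟩
    have hinj : Set.InjOn (N.nbr u) (Set.Iio (N.halfLabels u).length) := by
      intro i hi j hj hij
      rw [← (N.nbr_spec hi).2, ← (N.nbr_spec hj).2, hij]
    classical
    have h1 : (Set.toFinite (N.graph.neighborSet u)).toFinset =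
        (Finset.range (N.halfLabels u).length).image (N.nbr u) := by
      ext w
      rw [Set.Finite.mem_toFinset, ← hset]
      simp
    rw [h1, Finset.image_val_of_injOn (by simpa using hinj), Multiset.map_map]
    rfl

end Network

/-! ### Identifiers and prescribed size of the lifted instance -/

namespace Network

variable {c : ℕ} {N : Network c Color Unit}
  {hN : ∀ u w, N.graph.Adj u w → N.label u ≠ N.label w} {h : ℕ} {hh : 0 < h}

/-- The position of a gadget node in the block of identifiers of a node of an `n`-node network. -/
def offset (n h : ℕ) (tk : ℕ × ℕ) : ℕ :=
  if tk.1 = 0 then tk.2 else 2 * n + (tk.1 - 1) * 2 ^ h + tk.2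

/-- The number of identifiers reserved for each node of an `n`-node network. -/
def blockSize (n h : ℕ) : ℕ := n * (2 ^ h + 2)

theorem length_halfLabels_le (N : Network c Color Unit) (v : N.V) :
    (N.halfLabels v).length ≤ N.size := by
  rw [← N.degree_eq_length, degree, size, ← Nat.card_eq_fintype_card]
  exact Set.ncard_le_card _

theorem valid_layout_head {v : N.V} {k : ℕ} (hk : (N.layout hN h hh).Valid (v, 0, k)) :
    k < 2 * N.size := by
  have hn : 0 < N.size := Fintype.card_pos_iff.2 ⟨v⟩
  rcases eq_or_ne k 0 with rfl | hk0
  · omega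
  · obtain ⟨-, hd, -, hlt⟩ := hk.octopus hk0
    have h1 := Layout.pow_log_le hd
    simp only [Layout.hgt, pow_succ] at hlt
    have h2 : (N.layout hN h hh).deg v ≤ N.size := N.length_halfLabels_le v
    omega

theorem valid_layout_port {v : N.V} {i k : ℕ} (hk : (N.layout hN h hh).Valid (v, i + 1, k)) :
    i < N.size ∧ k < 2 ^ h := by
  have hk0 : k ≠ 0 := by
    rintro rfl
    exact absurd hk.inter.2 (by omega)
  obtain ⟨-, hd, hi, hlt⟩ := hk.octopus hk0
  have h2 : (N.layout hN h hh).deg v ≤ N.size := N.length_halfLabels_le v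
  exact ⟨by omega, hlt⟩

/-- A head-gadget has indices below `2 * n`, since `2 ^ (Nat.log 2 d + 1) ≤ 2 * d` and `d ≤ n`. It
is followed by at most `n` slots of length `2 ^ h`, one for each port-gadget. -/
theorem offset_lt {v : N.V} {tk : ℕ × ℕ} (hv : (N.layout hN h hh).Valid (v, tk)) :
    offset N.size h tk < blockSize N.size h := by
  have hn : 0 < N.size := Fintype.card_pos_iff.2 ⟨v⟩
  obtain ⟨_ | i, k⟩ := tk
  · have := valid_layout_head hv
    simp only [offset, blockSize, if_true]
    nlinarith [Nat.zero_le (N.size * 2 ^ h)]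
  · obtain ⟨h1, h2⟩ := valid_layout_port hv
    have h3 : (i + 1) * 2 ^ h ≤ N.size * 2 ^ h := Nat.mul_le_mul_right _ h1
    simp only [offset, blockSize, Nat.add_sub_cancel, Nat.succ_ne_zero, if_false]
    linarith

theorem offset_injective {v : N.V} {tk tk' : ℕ × ℕ} (hv : (N.layout hN h hh).Valid (v, tk))
    (hv' : (N.layout hN h hh).Valid (v, tk')) (he : offset N.size h tk = offset N.size h tk') :
    tk = tk' := by
  obtain ⟨_ | i, k⟩ := tk <;> obtain ⟨_ | i', k'⟩ := tk' <;>
    simp only [offset, Nat.add_sub_cancel, Nat.succ_ne_zero, if_false, if_true] at he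
  · rw [he]
  · have := valid_layout_head hv
    omega
  · have := valid_layout_head hv'
    omega
  · have h1 := (valid_layout_port hv).2
    have h2 := (valid_layout_port hv').2
    have h3 : 2 ^ h * i + k = 2 ^ h * i' + k' := by linarith
    have h4 := congrArg (· / 2 ^ h) h3
    simp only [Nat.mul_add_div (Nat.two_pow_pos h), Nat.div_eq_of_lt h1, Nat.div_eq_of_lt h2,
      add_zero] at h4
    subst h4
    rw [Nat.add_left_cancel h3]

theorem card_valid_layout_le :
    Nat.card {x // (N.layout hN h hh).Valid x} ≤ N.size * blockSize N.size h := by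
  rw [Layout.card_valid]
  refine (Finset.sum_le_card_nsmul _ _ (blockSize N.size h) fun v _ => ?_).trans (le_of_eq rfl)
  have := Set.ncard_le_ncard_of_injOn
    (s := {tk : ℕ × ℕ | (N.layout hN h hh).Valid (v, tk)}) (t := Set.Iio (blockSize N.size h)) (offset N.size h)
    (fun tk htk => offset_lt htk) (fun tk htk tk' htk' => offset_injective htk htk')
    (Set.finite_Iio _)
  simpa using this

/-- A proper instance with `M` nodes into which the bipartite network `N` has been turned: every
white node is replaced by an octopus gadget with port-gadgets of height `h`, and stars with
hyperedges of size `d` are added to reach the required number of nodes. The identifiers of the nodes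
of an octopus gadget depend only on the identifier of the white node and on `N.size`. -/
structure GadgetLift (N : Network c Color Unit)
    (hN : ∀ u w, N.graph.Adj u w → N.label u ≠ N.label w) (h : ℕ) (hh : 0 < h) (d M : ℕ) where
  m : ℕ
  k : ℕ
  card_eq : Nat.card {x // ((N.layout hN h hh).sum (Layout.stars d m k)).Valid x} = M
  id : {x // ((N.layout hN h hh).sum (Layout.stars d m k)).Valid x} → ℕ
  id_injective : Function.Injective id
  id_mem : ∀ x, id x ∈
    Set.Icc 1 (Nat.card {x // ((N.layout hN h hh).sum (Layout.stars d m k)).Valid x} ^ c)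
  id_eq : ∀ v tk hv, id ⟨(.inl v, tk), hv⟩ =
    (N.ident v - 1) * blockSize N.size h + offset N.size h tk + 1

/-- The bound on `M` serves twice: it leaves room for a padding of at least `6 * d + 3` nodes, and
it keeps the prescribed identifiers in range. -/
theorem nonempty_gadgetLift (hc : 1 ≤ c) {d M : ℕ}
    (hM : N.size * blockSize N.size h + (6 * d + 3) ≤ M) : Nonempty (N.GadgetLift hN h hh d M) := by
  set K := blockSize N.size h with hK
  have hle : Nat.card {x // (N.layout hN h hh).Valid x} ≤ N.size * K := card_valid_layout_le
  obtain ⟨m, k, hkm, hR⟩ := Layout.exists_stars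
    (show 6 * d + 3 ≤ M - Nat.card {x // (N.layout hN h hh).Valid x} by omega)
  have hcard : Nat.card {x // ((N.layout hN h hh).sum (Layout.stars d m k)).Valid x} = M := by
    rw [Layout.card_valid_sum, Layout.card_valid_stars hkm, hR]
    omega
  let s : Set {x // ((N.layout hN h hh).sum (Layout.stars d m k)).Valid x} :=
    {x | x.1.1.isLeft}
  let f : {x // ((N.layout hN h hh).sum (Layout.stars d m k)).Valid x} → ℕ :=
    fun x => x.1.1.elim (fun v => (N.ident v - 1) * K + offset N.size h x.1.2 + 1) fun _ => 0
  have hf : Set.InjOn f s := by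
    rintro ⟨⟨v | v, tk⟩, hv⟩ hs ⟨⟨w | w, tk'⟩, hw⟩ hs' he
    · have hv : (N.layout hN h hh).Valid (v, tk) := Layout.valid_sum_inl.1 hv
      have hw : (N.layout hN h hh).Valid (w, tk') := Layout.valid_sum_inl.1 hw
      simp only [f, Sum.elim_inl, Nat.add_right_cancel_iff] at he
      have h1 : offset N.size h tk < K := offset_lt hv
      have h2 : offset N.size h tk' < K := offset_lt hw
      rw [mul_comm, mul_comm _ K] at he
      have h3 := congrArg (· / K) he
      simp only [Nat.mul_add_div (Nat.zero_lt_of_lt h1), Nat.div_eq_of_lt h1, Nat.div_eq_of_lt h2,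
        add_zero] at h3
      have h4 := (N.ident_mem v).1
      have h5 := (N.ident_mem w).1
      obtain rfl := N.ident_injective (show N.ident v = N.ident w by omega)
      obtain rfl := offset_injective hv hw (Nat.add_left_cancel he)
      rfl
    · simp [s] at hs'
    · simp [s] at hs
    · simp [s] at hs
  have hmaps : Set.MapsTo f s (Set.Icc 1 (M ^ c)) := by
    rintro ⟨⟨v | v, tk⟩, hv⟩ hs
    · have hv := Layout.valid_sum_inl.1 hv
      have h1 : offset N.size h tk < K := offset_lt hv
      have h2 := N.ident_mem v
      refine ⟨Nat.succ_le_succ (Nat.zero_le _), ?_⟩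
      -- There are `n ^ c` possible blocks of length `K`, and `n ^ c * K ≤ (n * K) ^ c` because `c ≥
      -- 1`.
      have h3 : N.size ^ c * K ≤ M ^ c := calc
        N.size ^ c * K ≤ N.size ^ c * K ^ c :=
          Nat.mul_le_mul_left _ (Nat.le_self_pow (by omega) K)
        _ = (N.size * K) ^ c := (mul_pow _ _ _).symm
        _ ≤ M ^ c := Nat.pow_le_pow_left (by omega) _
      have h4 : N.ident v * K ≤ N.size ^ c * K := Nat.mul_le_mul_right _ h2.2
      obtain ⟨i, hi⟩ : ∃ i, N.ident v = i + 1 := ⟨N.ident v - 1, by have := h2.1; omega⟩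
      simp only [f, Sum.elim_inl, hi, Nat.add_sub_cancel]
      rw [hi] at h4
      linarith
    · simp [s] at hs
  obtain ⟨g, hg, hg', hgf⟩ := exists_injective_extension hf hmaps
    (hcard.le.trans (Nat.le_self_pow (by omega) M))
  exact ⟨⟨m, k, hcard, g, hg, hcard ▸ hg', fun v tk hv => hgf (x := ⟨(.inl v, tk), hv⟩) rfl⟩⟩

namespace GadgetLift

variable {d M : ℕ} (D : N.GadgetLift hN h hh d M)

noncomputable abbrev layout : Layout (N.V ⊕ Fin D.m × Option (Fin d)) :=
  (N.layout hN h hh).sum (Layout.stars d D.m D.k)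

noncomputable def network : Network c NodeKind HalfKind :=
  D.layout.network c D.id D.id_injective D.id_mem

theorem size_network : D.network.size = M := Layout.size_network.trans D.card_eq

theorem network_mem {S : Type} {P : LinearizableProblem S} (hNP : N ∈ (P.problem c).inputs)
    (hd : d ∈ P.sizes) : D.network ∈ (P.promise c).inputs := by
  refine Layout.network_mem_promise P ?_
  rintro (v | ⟨a, _ | b⟩) hv
  · have hb : N.label v = .black := by
      have hv : ¬ N.label v = .white := hv
      cases h : N.label v
      · exact absurd h hv
      · rfl
    have := hNP.2 v hb
    rwa [N.degree_eq_length] at this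
  · exact hd
  · exact absurd rfl hv

/-- The output on `N` that is read off from an output on the proper instance. -/
noncomputable def decode {S : Type} (y : D.network.V → Option S) (v : N.V) : List S :=
  D.layout.decode y (.inl v)

theorem decode_solution {S : Type} {P : LinearizableProblem S} (hNP : N ∈ (P.problem c).inputs)
    {y : D.network.V → Option S} (hy : (P.promise c).Solution D.network y) :
    (P.problem c).Solution N (D.decode y) := by
  have hy : D.network.gadgetGraph.PromiseSolution P y := hy
  have h1 : D.network.gadgetGraph = D.layout.gadgetGraph := Layout.gadgetGraph_network
  have h2 : D.layout.gadgetGraph.PromiseSolution P y := h1 ▸ hy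
  exact Network.decode_solution hNP h2

end GadgetLift

end Network

/-! ### Views, and distances in the lifted instance -/

namespace Network

section Ball

variable {c : ℕ} {X Y : Type} {N : Network c X Y} {A : Set N.V}

theorem mem_ball_zero {v : N.V} : v ∈ N.ball A 0 ↔ v ∈ A := by
  constructor
  · rintro ⟨a, ha, h⟩
    rw [Nat.cast_zero, nonpos_iff_eq_zero, SimpleGraph.edist_eq_zero_iff] at h
    exact h ▸ ha
  · exact fun h => ⟨v, h, by simp⟩

theorem ball_mono {s t : ℕ} (h : s ≤ t) : N.ball A s ⊆ N.ball A t :=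
  fun _ ⟨a, ha, hv⟩ => ⟨a, ha, hv.trans (by exact_mod_cast h)⟩

theorem ball_subset {A' : Set N.V} (h : A ⊆ A') {s : ℕ} : N.ball A s ⊆ N.ball A' s :=
  fun _ ⟨a, ha, hv⟩ => ⟨a, h ha, hv⟩

theorem subset_ball {s : ℕ} : A ⊆ N.ball A s := fun v h => ⟨v, h, by simp⟩

theorem mem_ball_of_adj {s : ℕ} {u v : N.V} (hu : u ∈ N.ball A s) (h : N.graph.Adj u v) :
    v ∈ N.ball A (s + 1) := by
  obtain ⟨a, ha, hd⟩ := hu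
  refine ⟨a, ha, SimpleGraph.edist_triangle.trans (?_ : N.graph.edist a u + N.graph.edist u v ≤ _)⟩
  rw [SimpleGraph.edist_eq_one_iff_adj.2 h]
  push_cast
  gcongr

theorem mem_ball_succ {s : ℕ} {v : N.V} :
    v ∈ N.ball A (s + 1) ↔ v ∈ N.ball A s ∨ ∃ u ∈ N.ball A s, N.graph.Adj u v := by
  constructor
  · rintro ⟨a, ha, hd⟩
    rw [SimpleGraph.edist_comm] at hd
    obtain ⟨p, hp⟩ := SimpleGraph.exists_walk_of_edist_ne_top
      (ne_top_of_le_ne_top (ENat.natCast_ne_top _) hd)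
    rw [← hp] at hd
    have hd : p.length ≤ s + 1 := by exact_mod_cast hd
    cases p with
    | nil => exact .inl (subset_ball ha)
    | cons h q =>
      refine .inr ⟨_, ⟨a, ha, ?_⟩, h.symm⟩
      rw [SimpleGraph.edist_comm]
      refine q.edist_le.trans ?_
      rw [SimpleGraph.Walk.length_cons] at hd
      exact_mod_cast Nat.le_of_succ_le_succ hd
  · rintro (h | ⟨u, hu, h⟩)
    · exact ball_mono (Nat.le_succ s) h
    · exact mem_ball_of_adj hu h

theorem mem_openBall_iff {T : ℕ} {v : N.V} : v ∈ N.openBall A T ↔ ∃ s < T, v ∈ N.ball A s := by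
  constructor
  · rintro ⟨a, ha, h⟩
    obtain ⟨s, hs⟩ := ENat.ne_top_iff_exists.1 (ne_top_of_lt h)
    rw [← hs] at h
    exact ⟨s, by exact_mod_cast h, a, ha, hs.symm.le⟩
  · rintro ⟨s, hs, a, ha, h⟩
    exact ⟨a, ha, lt_of_le_of_lt h (by exact_mod_cast hs)⟩

theorem ViewAdj.symm {T : ℕ} {u w : N.V} (h : N.ViewAdj A T u w) : N.ViewAdj A T w u :=
  ⟨h.1.symm, h.2.2.1, h.2.1, h.2.2.2.symm⟩

theorem viewAdj_of_mem_ball {s T : ℕ} (hs : s < T) {u w : N.V} (hu : u ∈ N.ball A s)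
    (h : N.graph.Adj u w) : N.ViewAdj A T u w :=
  ⟨h, ball_mono hs.le hu, ball_mono hs (mem_ball_of_adj hu h), .inl (mem_openBall_iff.2 ⟨s, hs, hu⟩)⟩

variable {H : Network c X Y} {B : Set H.V} {φ : N.V → H.V} {ψ : H.V → N.V} {T : ℕ}

theorem ViewIso.symm (h : ViewIso N H A B T φ) (hψ : Set.LeftInvOn ψ φ (N.ball A T)) :
    ViewIso H N B A T ψ := by
  have hr : Set.LeftInvOn φ ψ (H.ball B T) := by
    intro w hw
    obtain ⟨v, hv, rfl⟩ := h.bijOn.surjOn hw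
    rw [hψ hv]
  have hb : Set.BijOn ψ (H.ball B T) (N.ball A T) := h.bijOn.symm ⟨hr, hψ⟩
  refine ⟨hb, fun u hu w hw => ?_, fun u w huw => ?_, fun u hu => ?_, fun u hu => ?_,
    fun u hu => ?_⟩
  · rw [h.adj_iff _ (hb.mapsTo hu) _ (hb.mapsTo hw), hr hu, hr hw]
  · have hu := huw.2.1
    have hw := huw.2.2.1
    have := h.port_eq (ψ u) (ψ w)
      ((h.adj_iff _ (hb.mapsTo hu) _ (hb.mapsTo hw)).2 (by rwa [hr hu, hr hw]))
    rw [hr hu, hr hw] at this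
    exact this.symm
  · rw [h.ident_eq _ (hb.mapsTo hu), hr hu]
  · rw [h.label_eq _ (hb.mapsTo hu), hr hu]
  · rw [h.halfLabels_eq _ (hb.mapsTo hu), hr hu]

end Ball

theorem log_le_succ {k k' : ℕ} (h : k' ≤ 2 * k + 1) (hk : k ≠ 0) :
    Nat.log 2 k' ≤ Nat.log 2 k + 1 := by
  refine (Nat.log_mono_right h).trans ?_
  rw [Nat.log_of_one_lt_of_le (by norm_num) (by omega), show (2 * k + 1) / 2 = k by omega]

variable {c : ℕ}

section Near

variable {N : Network c Color Unit}
  {hN : ∀ u w, N.graph.Adj u w → N.label u ≠ N.label w} {h : ℕ} {hh : 0 < h}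
  {V' : Type} {L' : Layout V'}

/-- What is known about a node `x` at distance at most `s` from the roots of the port-gadgets of the
nodes in `W`, when crossing a port-gadget takes `h` steps. -/
def Near (N : Network c Color Unit) (h : ℕ) (W : Set N.V) (s : ℕ) (x : (N.V ⊕ V') × ℕ × ℕ) : Prop :=
  ∃ v δ, x.1 = .inl v ∧
    ((v ∈ N.ball W δ ∧ δ * h + (if x.2.1 = 0 then 0 else Nat.log 2 x.2.2) ≤ s) ∨
      (x.2.1 ≠ 0 ∧ N.nbr v (x.2.1 - 1) ∈ N.ball W δ ∧ δ * h + h ≤ s + Nat.log 2 x.2.2))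

/-- `Nat.log 2 k` is the depth of node `k`. The two inequalities hold for every edge inside a tree
and say that the depth changes by at most one. -/
theorem Near.tree_step {W : Set N.V} {s t k k' : ℕ} {v : N.V ⊕ V'} (hx : N.Near h W s (v, t, k))
    (hk : k ≠ 0) (hk' : k' ≠ 0) (h1 : k' ≤ 2 * k + 1) (h2 : k ≤ 2 * k' + 1) :
    N.Near h W (s + 1) (v, t, k') := by
  have h3 := log_le_succ h1 hk
  have h4 := log_le_succ h2 hk'
  obtain ⟨v, δ, rfl, ⟨hv, hs⟩ | ⟨ht, hv, hs⟩⟩ := hx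
  · refine ⟨v, δ, rfl, .inl ⟨hv, ?_⟩⟩
    dsimp only at hs ⊢
    split_ifs at hs ⊢ <;> omega
  · refine ⟨v, δ, rfl, .inr ⟨ht, hv, ?_⟩⟩
    dsimp only at hs ⊢
    omega

/-- `Near` is a potential that drops distances inside head-gadgets and charges `h` for a full
crossing of a port-gadget. Its first alternative covers port-gadgets entered at the root, with cost
the depth; the second covers those entered at the left-most leaf, with cost `h` minus the depth.
Leaving at the opposite end completes the charge and raises `δ` by one. -/
theorem Near.step {W : Set N.V} {s : ℕ} {a : HalfKind} {x y : (N.V ⊕ V') × ℕ × ℕ}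
    (hx : N.Near h W s x) (hv : ((N.layout hN h hh).sum L').Valid x)
    (hs : ((N.layout hN h hh).sum L').step a x y) : N.Near h W (s + 1) y := by
  obtain ⟨v, t, k⟩ := x
  have hpow : Nat.log 2 (2 ^ (h - 1)) = h - 1 := Nat.log_pow (by norm_num) _
  rcases hs with ⟨hk, hc, rfl⟩ | ⟨hk, rfl, j, hj, rfl⟩
  · dsimp only at hk
    obtain ⟨-, hd, ht, -⟩ := hv.octopus hk
    cases a <;> simp only [Layout.Can, Layout.dest] at hc ⊢
    · have h1 : k ≠ 1 := fun h => hc (h ▸ isTwoPow_one)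
      exact hx.tree_step hk (by omega) (by omega) (by omega)
    · exact hx.tree_step hk (by omega) (by omega) (by omega)
    · exact hx.tree_step hk (by omega) (by omega) (by omega)
    · exact hx.tree_step hk (by omega) (by omega) (by omega)
    · exact hx.tree_step hk (by omega) (by omega) (by omega)
    · obtain ⟨v, δ, rfl, ⟨hv, hs⟩ | ⟨ht, -⟩⟩ := hx
      · refine ⟨v, δ, rfl, .inl ⟨hv, ?_⟩⟩
        simp only [hc.1, if_true] at hs
        simp
        omega
      · exact absurd hc.1 ht
    · obtain ⟨v, δ, rfl, ⟨hv, hs⟩ | ⟨ht, -⟩⟩ := hx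
      · refine ⟨v, δ, rfl, .inl ⟨hv, ?_⟩⟩
        simp only [hc.1, if_true] at hs
        simp
        omega
      · exact absurd hc.1 ht
    · obtain ⟨ht0, rfl⟩ := hc
      obtain ⟨v, δ, rfl, ⟨hv, hs⟩ | ⟨-, hv, hs⟩⟩ := hx
      · refine ⟨v, δ, rfl, .inl ⟨hv, ?_⟩⟩
        simp only [if_true]
        omega
      · have hi : t - 1 < (N.halfLabels v).length := lt_of_lt_of_le (by omega) ht
        refine ⟨v, δ + 1, rfl, .inl ⟨mem_ball_of_adj hv (N.nbr_spec hi).1.symm, ?_⟩⟩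
        simp only [Nat.log_one_right, if_true, add_mul] at hs ⊢
        omega
    · obtain ⟨ht0, rfl⟩ := hc
      obtain ⟨v, δ, rfl, ⟨hv, hs⟩ | ⟨-, hv, hs⟩⟩ := hx
      · have hi : t - 1 < (N.halfLabels v).length := lt_of_lt_of_le (by omega) ht
        refine ⟨N.nbr v (t - 1), δ + 1, rfl, .inl ⟨mem_ball_of_adj hv (N.nbr_spec hi).1, ?_⟩⟩
        have hs : δ * h + (if t = 0 then 0 else Nat.log 2 (2 ^ (h - 1))) ≤ s := hs
        simp only [ht0, if_false, hpow] at hs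
        simp only [if_true, add_mul]
        omega
      · refine ⟨N.nbr v (t - 1), δ, rfl, .inl ⟨hv, ?_⟩⟩
        have hs : δ * h + h ≤ s + Nat.log 2 (2 ^ (h - 1)) := hs
        rw [hpow] at hs
        simp only [if_true]
        omega
  · dsimp only at hk hj ⊢
    subst hk
    obtain ⟨-, rfl⟩ := hv.inter
    obtain ⟨v, δ, rfl, ⟨hv, hs⟩ | ⟨ht, -⟩⟩ := hx
    · refine ⟨N.nbr v j, δ, rfl, .inr ⟨Nat.succ_ne_zero _, ?_, ?_⟩⟩
      · change N.nbr (N.nbr v j) (N.port (N.nbr v j) v) ∈ _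
        rwa [N.nbr_port (N.nbr_spec hj).1.symm]
      · change δ * h + h ≤ s + 1 + Nat.log 2 (2 ^ (h - 1))
        simp only [if_true] at hs
        omega
    · exact absurd rfl ht

/-- The extra `1` is for port-gadgets entered from outside, whose owner is one step further than the
node they were entered from. If `T < h`, no port-gadget has been crossed; one entered from outside
would need a node of `W` as its black neighbor, but `W` is white. -/
theorem Near.zone {W : Set N.V} (hW : ∀ v ∈ W, N.label v = .white) {T t k : ℕ} {v : N.V}
    (hx : N.Near h W T ((.inl v, t, k) : (N.V ⊕ V') × ℕ × ℕ))
    (hv : ((N.layout hN h hh).sum L').Valid (.inl v, t, k)) :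
    v ∈ N.ball W (T / h + 1) ∧ (T < h → v ∈ W) := by
  have hv : (N.layout hN h hh).Valid (v, t, k) := Layout.valid_sum_inl.1 hv
  obtain ⟨v', δ, he, ⟨hb, hs⟩ | ⟨ht, hb, hs⟩⟩ := hx <;> obtain rfl := Sum.inl_injective he
  · have h1 : δ * h ≤ T := le_trans (Nat.le_add_right _ _) hs
    have h2 : δ ≤ T / h := (Nat.le_div_iff_mul_le hh).2 h1
    refine ⟨ball_mono (by omega) hb, fun hT => ?_⟩
    rw [Nat.div_eq_of_lt hT, Nat.le_zero] at h2
    subst h2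
    exact mem_ball_zero.1 hb
  · dsimp only at ht hb hs
    obtain ⟨i, rfl⟩ := Nat.exists_eq_succ_of_ne_zero ht
    have hk0 : k ≠ 0 := by
      rintro rfl
      exact ht hv.inter.2
    obtain ⟨hw, -, hi, hlt⟩ := hv.octopus hk0
    have hlog : Nat.log 2 k < h := Nat.log_lt_of_lt_pow hk0 hlt
    have h1 : δ * h ≤ T := by omega
    have h2 : δ ≤ T / h := (Nat.le_div_iff_mul_le hh).2 h1
    have hadj := (N.nbr_spec (v := v) (i := i) hi).1
    refine ⟨ball_mono (by omega) (mem_ball_of_adj hb hadj.symm), fun hT => ?_⟩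
    rw [Nat.div_eq_of_lt hT, Nat.le_zero] at h2
    subst h2
    exact absurd (Eq.trans hw (hW _ (mem_ball_zero.1 hb)).symm) (hN _ _ hadj)

end Near

end Network

/-! ### Lifting isomorphisms of views -/

namespace Network

variable {c : ℕ} {G H : Network c Color Unit}
  {hG : ∀ u w, G.graph.Adj u w → G.label u ≠ G.label w}
  {hH : ∀ u w, H.graph.Adj u w → H.label u ≠ H.label w} {h : ℕ} {hh : 0 < h}

/-- The map `φ` preserves the inputs of all nodes that are visible from `A` within distance `T` in
the lifted instances, and their neighborhoods if other nodes are visible at all. -/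
structure LocalIso (G H : Network c Color Unit) (A : Set G.V) (B : Set H.V) (h T : ℕ)
    (φ : G.V → H.V) : Prop where
  mapsTo : Set.MapsTo φ A B
  label : ∀ v ∈ G.ball A (T / h + 1), (T < h → v ∈ A) → G.label v = H.label (φ v)
  halfLabels : ∀ v ∈ G.ball A (T / h + 1), (T < h → v ∈ A) → G.halfLabels v = H.halfLabels (φ v)
  ident : ∀ v ∈ G.ball A (T / h + 1), (T < h → v ∈ A) → G.ident v = H.ident (φ v)
  nbr : ∀ v ∈ G.ball A (T / h + 1), h ≤ T → ∀ i < (G.halfLabels v).length,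
    H.nbr (φ v) i = φ (G.nbr v i) ∧ H.port (φ (G.nbr v i)) (φ v) = G.port (G.nbr v i) v

/-- For `T < h` only `A` itself matters and radius `0` suffices. Otherwise `q = T / h` is at least
`1`, and radius `3 * q > q + 1` shows all nodes within `q + 1` together with all their edges. -/
theorem ViewIso.localIso {A : Set G.V} {B : Set H.V} {φ : G.V → H.V} {T : ℕ} (hh : 0 < h)
    (h0 : ViewIso G H A B 0 φ) (hT : ViewIso G H A B (3 * (T / h)) φ) :
    LocalIso G H A B h T φ := by
  have hsub : ∀ v ∈ G.ball A (T / h + 1), (T < h → v ∈ A) → v ∈ G.ball A (3 * (T / h)) := by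
    intro v hv hvA
    rcases lt_or_ge T h with hlt | hge
    · exact subset_ball (hvA hlt)
    · have := Nat.div_pos hge hh
      exact ball_mono (by omega) hv
  refine ⟨fun v hv => ?_, fun v hv hvA => hT.label_eq v (hsub v hv hvA),
    fun v hv hvA => hT.halfLabels_eq v (hsub v hv hvA),
    fun v hv hvA => hT.ident_eq v (hsub v hv hvA), fun v hv hle i hi => ?_⟩
  · exact mem_ball_zero.1 (h0.bijOn.mapsTo (mem_ball_zero.2 hv))
  · have hpos := Nat.div_pos hle hh
    obtain ⟨hadj, hport⟩ := G.nbr_spec hi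
    have hview := viewAdj_of_mem_ball (show T / h + 1 < 3 * (T / h) by omega) hv hadj
    have hview' := (hT.adj_iff _ hview.2.1 _ hview.2.2.1).1 hview
    refine ⟨?_, (hT.port_eq _ _ hview.symm).symm⟩
    rw [← H.nbr_port hview'.1, ← hT.port_eq _ _ hview, hport]

section Step

variable {A : Set G.V} {B : Set H.V} {T : ℕ} {φ : G.V → H.V} {V₁ V₂ : Type} {L₁ : Layout V₁}
  {L₂ : Layout V₂}

theorem hgt_congr {v : G.V} {w : H.V} (hl : G.halfLabels v = H.halfLabels w) (t : ℕ) :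
    ((G.layout hG h hh).sum L₁).hgt (.inl v) t = ((H.layout hH h hh).sum L₂).hgt (.inl w) t := by
  cases t
  · change Nat.log 2 (G.halfLabels v).length + 1 = Nat.log 2 (H.halfLabels w).length + 1
    rw [hl]
  · rfl

theorem deg_congr {v : G.V} {w : H.V} (hl : G.halfLabels v = H.halfLabels w) :
    ((G.layout hG h hh).sum L₁).deg (.inl v) = ((H.layout hH h hh).sum L₂).deg (.inl w) :=
  congrArg List.length hl

theorem valid_congr {v : G.V} {w : H.V} (hl : G.halfLabels v = H.halfLabels w)
    (hlab : G.label v = H.label w) (tk : ℕ × ℕ) :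
    ((G.layout hG h hh).sum L₁).Valid (.inl v, tk) ↔
      ((H.layout hH h hh).sum L₂).Valid (.inl w, tk) := by
  have hw : ((G.layout hG h hh).sum L₁).white (.inl v) ↔
      ((H.layout hH h hh).sum L₂).white (.inl w) := by
    change G.label v = _ ↔ H.label w = _
    rw [hlab]
  simp only [Layout.Valid, hgt_congr (hG := hG) (hH := hH) (L₁ := L₁) (L₂ := L₂) hl,
    deg_congr (hG := hG) (hH := hH) (hh := hh) (L₁ := L₁) (L₂ := L₂) hl, hw]

theorem can_congr {v : G.V} {w : H.V} (hl : G.halfLabels v = H.halfLabels w) (a : HalfKind)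
    (tk : ℕ × ℕ) :
    ((G.layout hG h hh).sum L₁).Can a (.inl v, tk) ↔
      ((H.layout hH h hh).sum L₂).Can a (.inl w, tk) := by
  cases a <;> simp only [Layout.Can, hgt_congr (hG := hG) (hH := hH) (L₁ := L₁) (L₂ := L₂) hl,
    deg_congr (hG := hG) (hH := hH) (hh := hh) (L₁ := L₁) (L₂ := L₂) hl]
  rfl

theorem labels_congr {v : G.V} {w : H.V} (hl : G.halfLabels v = H.halfLabels w) (tk : ℕ × ℕ) :
    ((G.layout hG h hh).sum L₁).labels (.inl v, tk) =
      ((H.layout hH h hh).sum L₂).labels (.inl w, tk) := by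
  simp only [Layout.labels, deg_congr (hG := hG) (hH := hH) (hh := hh) (L₁ := L₁) (L₂ := L₂) hl]
  split_ifs
  · rfl
  · exact List.filter_congr fun a _ => decide_eq_decide.2 (can_congr hl a tk)

/-- Steps between visible nodes are preserved, together with their port numbers. -/
theorem LocalIso.step (hφ : LocalIso G H A B h T φ) {a : HalfKind} {v : G.V} {t k : ℕ}
    {y : (G.V ⊕ V₁) × ℕ × ℕ} (hv : v ∈ G.ball A (T / h + 1)) (hvA : T < h → v ∈ A)
    (hval : ((G.layout hG h hh).sum L₁).Valid (.inl v, t, k))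
    (hs : ((G.layout hG h hh).sum L₁).step a (.inl v, t, k) y)
    (ha : a = .outward ∨ a = .inward → h ≤ T) :
    ∃ v' tk', y = (.inl v', tk') ∧
      ((H.layout hH h hh).sum L₂).step a (.inl (φ v), t, k) (.inl (φ v'), tk') ∧
      ((G.layout hG h hh).sum L₁).portNum (.inl v, t, k) y =
        ((H.layout hH h hh).sum L₂).portNum (.inl (φ v), t, k) (.inl (φ v'), tk') := by
  have hl := hφ.halfLabels v hv hvA
  rcases eq_or_ne k 0 with rfl | hk
  · obtain ⟨rfl, j, hj, rfl⟩ := (Layout.step_inter rfl).1 hs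
    have hj : j < (G.halfLabels v).length := hj
    obtain ⟨h1, h2⟩ := hφ.nbr v hv (ha (.inr rfl)) j hj
    have he : ((.inl (φ (G.nbr v j)), G.port (G.nbr v j) v + 1, 2 ^ (h - 1)) :
        (H.V ⊕ V₂) × ℕ × ℕ) = ((H.layout hH h hh).sum L₂).inDest (.inl (φ v)) j := by
      change _ = (Sum.inl (H.nbr (φ v) j), H.port (H.nbr (φ v) j) (φ v) + 1, 2 ^ (h - 1))
      rw [h1, h2]
    have hj' : j < ((H.layout hH h hh).sum L₂).deg (.inl (φ v)) := by
      change j < (H.halfLabels (φ v)).length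
      rwa [← hl]
    refine ⟨G.nbr v j, (G.port (G.nbr v j) v + 1, 2 ^ (h - 1)), rfl, ?_, ?_⟩
    · rw [he]
      exact (Layout.step_inter rfl).2 ⟨rfl, j, hj', rfl⟩
    · rw [he, Layout.portNum_inDest hj', Layout.portNum_inDest]
      exact hj
  · obtain ⟨hc, rfl⟩ := (Layout.step_octopus hk).1 hs
    have hc' := (can_congr (hG := hG) (hH := hH) (hh := hh) (L₁ := L₁) (L₂ := L₂) hl a (t, k)).1 hc
    have hd := deg_congr (hG := hG) (hH := hH) (hh := hh) (L₁ := L₁) (L₂ := L₂) hl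
    obtain ⟨v', tk', he, he'⟩ : ∃ v' tk', ((G.layout hG h hh).sum L₁).dest a (.inl v, t, k) =
        (.inl v', tk') ∧ ((H.layout hH h hh).sum L₂).dest a (.inl (φ v), t, k) =
          (.inl (φ v'), tk') := by
      by_cases hao : a = .outward
      · subst hao
        have hi : t - 1 < (G.halfLabels v).length := by
          have h1 : t ≤ (G.halfLabels v).length := (hval.octopus hk).2.2.1
          have h2 := hc.1
          dsimp only at h2
          omega
        refine ⟨G.nbr v (t - 1), (0, 0), rfl, ?_⟩
        change (Sum.inl (H.nbr (φ v) (t - 1)), 0, 0) = _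
        rw [(hφ.nbr v hv (ha (.inl rfl)) _ hi).1]
      · refine ⟨v, (((G.layout hG h hh).sum L₁).dest a (.inl v, t, k)).2, ?_, ?_⟩
        · cases a <;> first | rfl | exact absurd rfl hao
        · cases a <;> first | exact absurd rfl hao | simp only [Layout.dest, hd]
    have hs' : ((H.layout hH h hh).sum L₂).step a (.inl (φ v), t, k) (.inl (φ v'), tk') :=
      (Layout.step_octopus hk).2 ⟨hc', he'.symm⟩
    refine ⟨v', tk', he, hs', ?_⟩
    have h1 := Layout.labels_portNum hs
    have h2 := Layout.labels_portNum hs'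
    rw [labels_congr (hH := hH) (L₂ := L₂) hl] at h1
    rw [List.getElem?_eq_some_iff] at h1 h2
    obtain ⟨h1, h1'⟩ := h1
    obtain ⟨h2, h2'⟩ := h2
    exact (Layout.nodup_labels (x := (Sum.inl (φ v), t, k)) hk).getElem_inj_iff.1
      (h1'.trans h2'.symm)

end Step

namespace GadgetLift

variable {d M : ℕ} (DG : G.GadgetLift hG h hh d M) (DH : H.GadgetLift hH h hh d M)

/-- The roots of the port-gadgets of the white nodes in `A`. -/
def roots (A : Set G.V) : Set DG.network.V :=
  {x | ∃ v ∈ A, G.label v = .white ∧ ∃ i, Subtype.val x = (.inl v, i + 1, 1)}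

open Classical in
/-- The map between lifted instances that corresponds to `φ`. -/
noncomputable def liftMap [hne : Nonempty DH.network.V] (φ : G.V → H.V) :
    DG.network.V → DH.network.V :=
  fun x => if hx : ∃ y : DH.network.V, ∃ v tk, Subtype.val x = (.inl v, tk) ∧
    Subtype.val y = (.inl (φ v), tk) then hx.choose else Classical.choice hne

variable {DG DH}

theorem id_of_val (DG : G.GadgetLift hG h hh d M) {x : DG.network.V} {v : G.V} {tk : ℕ × ℕ}
    (hx : Subtype.val x = (.inl v, tk)) :
    DG.id x = (G.ident v - 1) * blockSize G.size h + offset G.size h tk + 1 := by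
  rw [← DG.id_eq v tk (hx ▸ x.2)]
  exact congrArg DG.id (Subtype.ext hx)

theorem liftMap_eq [Nonempty DH.network.V] {φ : G.V → H.V} {x : DG.network.V} {y : DH.network.V}
    {v : G.V} {tk : ℕ × ℕ} (hx : Subtype.val x = (.inl v, tk))
    (hy : Subtype.val y = (.inl (φ v), tk)) : liftMap DG DH φ x = y := by
  have hex : ∃ y : DH.network.V, ∃ v tk, Subtype.val x = (.inl v, tk) ∧
    Subtype.val y = (.inl (φ v), tk) := ⟨y, v, tk, hx, hy⟩
  rw [liftMap, dif_pos hex]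
  obtain ⟨v', tk', h1, h2⟩ := hex.choose_spec
  rw [hx] at h1
  obtain ⟨h3, rfl⟩ := Prod.mk.inj h1
  obtain rfl := Sum.inl_injective h3
  exact Subtype.ext (h2.trans hy.symm)

theorem near_of_mem_ball {A : Set G.V} {s : ℕ} {x : DG.network.V}
    (hx : x ∈ DG.network.ball (DG.roots A) s) :
    G.Near h {v ∈ A | G.label v = .white} s (Subtype.val x) := by
  induction s generalizing x with
  | zero =>
    obtain ⟨v, hv, hw, i, he⟩ := mem_ball_zero.1 hx
    refine ⟨v, 0, by rw [he], .inl ⟨mem_ball_zero.2 ⟨hv, hw⟩, ?_⟩⟩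
    rw [he]
    simp
  | succ s ih =>
    rcases mem_ball_succ.1 hx with hx | ⟨u, hu, a, ha⟩
    · obtain ⟨v, δ, h1, h2⟩ := ih hx
      exact ⟨v, δ, h1, h2.imp (fun h => ⟨h.1, by omega⟩) fun h => ⟨h.1, h.2.1, by omega⟩⟩
    · exact (ih hu).step u.2 ha

/-- The node of `G` to which a visible node belongs. -/
theorem exists_base {A : Set G.V} {T : ℕ} {x : DG.network.V}
    (hx : x ∈ DG.network.ball (DG.roots A) T) : ∃ v tk, Subtype.val x = (.inl v, tk) ∧
      v ∈ G.ball A (T / h + 1) ∧ (T < h → v ∈ A ∧ G.label v = .white) := by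
  have hn := near_of_mem_ball hx
  obtain ⟨⟨v | v, t, k⟩, hv⟩ := x
  · have hz := hn.zone (fun v hv => hv.2) hv
    exact ⟨v, (t, k), rfl, ball_subset (fun v hv => hv.1) hz.1, hz.2⟩
  · obtain ⟨v', δ, h1, -⟩ := hn
    exact absurd h1 (by simp)

variable {A : Set G.V} {B : Set H.V} {T : ℕ} {φ : G.V → H.V} [Nonempty DH.network.V]

theorem val_liftMap (hφ : LocalIso G H A B h T φ) {x : DG.network.V} {v : G.V} {tk : ℕ × ℕ}
    (hx : Subtype.val x = (.inl v, tk)) (hv : v ∈ G.ball A (T / h + 1)) (hvA : T < h → v ∈ A) :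
    Subtype.val (liftMap DG DH φ x) = (.inl (φ v), tk) := by
  have h1 : DH.layout.Valid (.inl (φ v), tk) :=
    (valid_congr (hφ.halfLabels v hv hvA) (hφ.label v hv hvA) tk).1 (hx ▸ x.2 :
      DG.layout.Valid (.inl v, tk))
  rw [liftMap_eq (y := ⟨_, h1⟩) hx rfl]

theorem step_liftMap (hφ : LocalIso G H A B h T φ) {x y : DG.network.V} {a : HalfKind}
    (hx : x ∈ DG.network.ball (DG.roots A) T) (hy : y ∈ DG.network.ball (DG.roots A) T)
    (hs : DG.layout.step a (Subtype.val x) (Subtype.val y)) :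
    DH.layout.step a (Subtype.val (liftMap DG DH φ x)) (Subtype.val (liftMap DG DH φ y)) ∧
      DG.network.port x y = DH.network.port (liftMap DG DH φ x) (liftMap DG DH φ y) := by
  obtain ⟨v, ⟨t, k⟩, hxv, hv, hvA⟩ := exists_base hx
  obtain ⟨w, ⟨t', k'⟩, hyw, hw, hwA⟩ := exists_base hy
  -- For `T < h` all visible nodes belong to white nodes, so a visible inter-octopus node forces `h
  -- ≤ T`, as needed to control edges between octopus and inter-octopus nodes.
  have hbase : ∀ {z : DG.network.V} {u : G.V} {t : ℕ}, Subtype.val z = (.inl u, t, 0) →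
      (T < h → u ∈ A ∧ G.label u = .white) → h ≤ T := by
    intro z u t hz hu
    by_contra hlt
    have h1 : DG.layout.Valid (.inl u, t, 0) := hz ▸ z.2
    exact h1.inter.1 (hu (by omega)).2
  have hval : DG.layout.Valid (.inl v, t, k) := hxv ▸ x.2
  have hs' := hs
  rw [hxv] at hs'
  obtain ⟨w', tk', h1, h2, h3⟩ := hφ.step (hH := hH) (L₂ := Layout.stars d DH.m DH.k) hv
    (fun h => (hvA h).1) hval hs' (by
      rintro (rfl | rfl)
      · have hk : k ≠ 0 := by
          rintro rfl
          exact absurd ((Layout.step_inter rfl).1 hs').1 (by simp)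
        have h1 := ((Layout.step_octopus hk).1 hs').2
        rw [hyw] at h1
        obtain ⟨-, h1⟩ := Prod.mk.inj h1
        obtain ⟨-, rfl⟩ := Prod.mk.inj h1
        exact hbase hyw hwA
      · have hk : k = 0 := by
          by_contra hk
          exact ((Layout.step_octopus hk).1 hs').1
        subst hk
        exact hbase hxv hvA)
  rw [hyw] at h1 h3
  obtain ⟨h4, rfl⟩ := Prod.mk.inj h1
  obtain rfl := Sum.inl_injective h4
  have hx' := val_liftMap (DH := DH) hφ hxv hv fun h => (hvA h).1
  have hy' := val_liftMap (DH := DH) hφ hyw hw fun h => (hwA h).1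
  change _ ∧ DG.layout.portNum (Subtype.val x) (Subtype.val y) =
    DH.layout.portNum (Subtype.val (liftMap DG DH φ x)) (Subtype.val (liftMap DG DH φ y))
  rw [hx', hy', hxv, hyw]
  exact ⟨h2, h3⟩

theorem mem_ball_liftMap (hφ : LocalIso G H A B h T φ) {s : ℕ} (hs : s ≤ T) {x : DG.network.V}
    (hx : x ∈ DG.network.ball (DG.roots A) s) :
    liftMap DG DH φ x ∈ DH.network.ball (DH.roots B) s := by
  induction s generalizing x with
  | zero =>
    obtain ⟨v, hv, hw, i, he⟩ := mem_ball_zero.1 hx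
    refine mem_ball_zero.2 ⟨φ v, hφ.mapsTo hv, ?_, i,
      val_liftMap hφ he (subset_ball hv) fun _ => hv⟩
    rw [← hφ.label v (subset_ball hv) fun _ => hv, hw]
  | succ s ih =>
    rcases mem_ball_succ.1 hx with hx' | ⟨u, hu, a, ha⟩
    · exact ball_mono (Nat.le_succ s) (ih (by omega) hx')
    · exact mem_ball_of_adj (ih (by omega) hu)
        ⟨a, (step_liftMap hφ (ball_mono (by omega) hu) (ball_mono hs hx) ha).1⟩

theorem viewAdj_liftMap (hφ : LocalIso G H A B h T φ) {x y : DG.network.V}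
    (hxy : DG.network.ViewAdj (DG.roots A) T x y) :
    DH.network.ViewAdj (DH.roots B) T (liftMap DG DH φ x) (liftMap DG DH φ y) := by
  obtain ⟨⟨a, ha⟩, hx, hy, ho⟩ := hxy
  refine ⟨⟨a, (step_liftMap hφ hx hy ha).1⟩, mem_ball_liftMap hφ le_rfl hx,
    mem_ball_liftMap hφ le_rfl hy, ?_⟩
  simp only [mem_openBall_iff] at ho ⊢
  exact ho.imp (fun ⟨s, hs, h⟩ => ⟨s, hs, mem_ball_liftMap hφ hs.le h⟩)
    fun ⟨s, hs, h⟩ => ⟨s, hs, mem_ball_liftMap hφ hs.le h⟩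

theorem liftMap_liftMap [Nonempty DG.network.V] {ψ : H.V → G.V} (hφ : LocalIso G H A B h T φ)
    (hψ : ∀ v ∈ G.ball A (T / h + 1), (T < h → v ∈ A) → ψ (φ v) = v) {x : DG.network.V}
    (hx : x ∈ DG.network.ball (DG.roots A) T) :
    liftMap DH DG ψ (liftMap DG DH φ x) = x := by
  obtain ⟨v, tk, hxv, hv, hvA⟩ := exists_base hx
  exact liftMap_eq (val_liftMap hφ hxv hv fun h => (hvA h).1)
    (by rw [hψ v hv fun h => (hvA h).1, hxv])

/-- Both maps send steps to steps and are mutually inverse on the visible nodes, so bijectivity and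
the converse direction for edges come from applying the same facts to `ψ`. Equal sizes are needed
because identifiers are computed from the size. -/
theorem viewIso_liftMap [Nonempty DG.network.V] {ψ : H.V → G.V} (hsize : G.size = H.size)
    (hφ : LocalIso G H A B h T φ) (hψ : LocalIso H G B A h T ψ)
    (hψφ : ∀ v ∈ G.ball A (T / h + 1), (T < h → v ∈ A) → ψ (φ v) = v)
    (hφψ : ∀ v ∈ H.ball B (T / h + 1), (T < h → v ∈ B) → φ (ψ v) = v) :
    ViewIso DG.network DH.network (DG.roots A) (DH.roots B) T (liftMap DG DH φ) := by
  refine ⟨⟨fun x hx => mem_ball_liftMap hφ le_rfl hx, fun x hx y hy he => ?_, fun y hy => ?_⟩,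
    fun x hx y hy => ⟨viewAdj_liftMap hφ, fun hxy => ?_⟩, fun x y hxy => ?_, fun x hx => ?_,
    fun x hx => ?_, fun x hx => ?_⟩
  · rw [← liftMap_liftMap (DH := DH) hφ hψφ hx, he, liftMap_liftMap hφ hψφ hy]
  · exact ⟨liftMap DH DG ψ y, mem_ball_liftMap hψ le_rfl hy, liftMap_liftMap hψ hφψ hy⟩
  · have := viewAdj_liftMap (DH := DG) hψ hxy
    rwa [liftMap_liftMap hφ hψφ hx, liftMap_liftMap hφ hψφ hy] at this
  · obtain ⟨⟨a, ha⟩, hx, hy, -⟩ := hxy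
    exact (step_liftMap hφ hx hy ha).2
  all_goals
    obtain ⟨v, tk, hxv, hv, hvA⟩ := exists_base hx
    have hx' := val_liftMap (DH := DH) hφ hxv hv fun h => (hvA h).1
  · change DG.id x = DH.id (liftMap DG DH φ x)
    rw [DG.id_of_val hxv, DH.id_of_val hx', hsize, hφ.ident v hv fun h => (hvA h).1]
  · change Layout.kind (Subtype.val x) = Layout.kind (Subtype.val (liftMap DG DH φ x))
    rw [hx', hxv]
    rfl
  · change DG.layout.labels (Subtype.val x) = DH.layout.labels (Subtype.val (liftMap DG DH φ x))
    rw [hx', hxv]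
    exact labels_congr (hφ.halfLabels v hv fun h => (hvA h).1) tk

/-- The lift of an isomorphism of views. -/
theorem viewIso_of_viewIso [Nonempty DG.network.V] (hsize : G.size = H.size)
    (h0 : ViewIso G H A B 0 φ) (hT : ViewIso G H A B (3 * (T / h)) φ) :
    ViewIso DG.network DH.network (DG.roots A) (DH.roots B) T (liftMap DG DH φ) := by
  -- `Function.invFunOn` needs a nonempty domain; without nodes, any map serves as the inverse.
  rcases isEmpty_or_nonempty G.V with hemp | hne
  · have : IsEmpty H.V := by
      rw [← Fintype.card_eq_zero_iff]
      exact hsize.symm.trans (Fintype.card_eq_zero_iff.2 hemp)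
    exact viewIso_liftMap (ψ := isEmptyElim) hsize (h0.localIso hh hT)
      ⟨fun w => isEmptyElim w, fun w => isEmptyElim w, fun w => isEmptyElim w,
        fun w => isEmptyElim w, fun w => isEmptyElim w⟩ (fun v => isEmptyElim v)
      fun w => isEmptyElim w
  have hinv := hT.bijOn.injOn.leftInvOn_invFunOn
  set ψ := Function.invFunOn φ (G.ball A (3 * (T / h)))
  have hT' := hT.symm hinv
  have h0' := h0.symm (hinv.mono (ball_mono (Nat.zero_le _)))
  have hsub : ∀ {N : Network c Color Unit} {A : Set N.V}, ∀ v ∈ N.ball A (T / h + 1),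
      (T < h → v ∈ A) → v ∈ N.ball A (3 * (T / h)) := by
    intro N A v hv hvA
    rcases lt_or_ge T h with hlt | hge
    · exact subset_ball (hvA hlt)
    · have := Nat.div_pos hge hh
      exact ball_mono (by omega) hv
  refine viewIso_liftMap (ψ := ψ) hsize (h0.localIso hh hT) (h0'.localIso hh hT')
    (fun v hv hvA => hinv (hsub v hv hvA)) fun w hw hwB => ?_
  have hw := hsub w hw hwB
  obtain ⟨v, hv, rfl⟩ := hT.bijOn.surjOn hw
  rw [hinv hv]

end GadgetLift

end Network

/-! ### Transfer of outcomes -/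

namespace Network.GadgetLift

variable {c : ℕ} {G H : Network c Color Unit}
  {hG : ∀ u w, G.graph.Adj u w → G.label u ≠ G.label w}
  {hH : ∀ u w, H.graph.Adj u w → H.label u ≠ H.label w} {h : ℕ} {hh : 0 < h} {d M : ℕ} {S : Type}

open Classical in
/-- The outputs of the nodes in `A`, read off from the labels of the roots of their port-gadgets. -/
noncomputable def decodeRoots (DG : G.GadgetLift hG h hh d M) (A : Set G.V)
    (g : DG.roots A → Option S) (a : A) : List S :=
  if hw : G.label a = .white then (List.range (G.halfLabels a).length).filterMap fun i =>
    if hi : DG.layout.Valid (.inl a.1, i + 1, 1) then g ⟨⟨_, hi⟩, a, a.2, hw, i, rfl⟩ else none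
  else []

theorem decode_eq_decodeRoots (DG : G.GadgetLift hG h hh d M) (A : Set G.V)
    (y : DG.network.V → Option S) :
    (fun a : A => DG.decode y a) = DG.decodeRoots A fun x => y x.1 := by
  funext a
  rw [decodeRoots]
  by_cases hw : G.label a = .white
  · rw [dif_pos hw]
    exact if_pos (show DG.layout.white (.inl a.1) from hw)
  · rw [dif_neg hw]
    exact if_neg (show ¬ DG.layout.white (.inl a.1) from hw)

/-- With `decode_eq_decodeRoots`, this shows that the decoded outputs on `A` and on its image are
the same function of the root labels, so an equality of laws on the roots pushes forward. -/
theorem decode_comp_eq_decodeRoots (DG : G.GadgetLift hG h hh d M) (DH : H.GadgetLift hH h hh d M)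
    [Nonempty DH.network.V] {A : Set G.V} {B : Set H.V} {φ : G.V → H.V}
    (h0 : ViewIso G H A B 0 φ) (y : DH.network.V → Option S) :
    (fun a : A => DH.decode y (φ a)) = DG.decodeRoots A fun x => y (liftMap DG DH φ x.1) := by
  funext a
  have ha := mem_ball_zero.2 a.2
  have hlab := h0.label_eq _ ha
  have hl := h0.halfLabels_eq _ ha
  rw [decodeRoots]
  by_cases hw : G.label a = .white
  · rw [dif_pos hw]
    refine (if_pos (show DH.layout.white (.inl (φ a.1)) from hlab.symm.trans hw)).trans ?_
    change List.filterMap _ (List.range (H.halfLabels (φ a)).length) = _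
    rw [hl]
    refine List.filterMap_congr fun i _ => ?_
    by_cases hi : DG.layout.Valid (.inl a.1, i + 1, 1)
    · have hi' : DH.layout.Valid (.inl (φ a.1), i + 1, 1) := (valid_congr hl hlab _).1 hi
      rw [dif_pos hi, dif_pos hi']
      exact congrArg y (liftMap_eq (x := ⟨_, hi⟩) (y := ⟨_, hi'⟩) rfl rfl).symm
    · have hi' : ¬ DH.layout.Valid (.inl (φ a.1), i + 1, 1) :=
        fun h => hi ((valid_congr hl hlab _).2 h)
      rw [dif_neg hi, dif_neg hi']
  · rw [dif_neg hw]
    exact if_neg (show ¬ DH.layout.white (.inl (φ a.1)) from fun h => hw (hlab.trans h))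

end Network.GadgetLift

namespace LinearizableProblem

variable {S : Type} {P : LinearizableProblem S} {c : ℕ}

open Network in
/-- An outcome for the promise problem, run on the lifted instances, solves the linearizable
problem. -/
theorem solvableNS_of_promise (hc : 1 ≤ c) {d : ℕ} (hd : d ∈ P.sizes) {p : ℕ → ℝ} (hp : Antitone p)
    {T : ℕ → ℕ} (hs : (P.promise c).SolvableNS p T) {M h : ℕ → ℕ} (hh : ∀ n, 0 < h n)
    (hM : ∀ n, n * blockSize n (h n) + (6 * d + 3) ≤ M n) :
    (P.problem c).SolvableNS p fun n => 3 * (T (M n) / h n) := by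
  classical
  obtain ⟨O, hO, hsol⟩ := hs
  have hD : ∀ n (N : Network c Color Unit) (hN : N ∈ (P.problem c).inputs), N.size = n →
      Nonempty (N.GadgetLift hN.1 (h n) (hh n) d (M n)) := by
    rintro _ N hN rfl
    exact nonempty_gadgetLift hc (hM _)
  -- Indexing by `n` with a proof of `N.size = n` gives two networks of equal size lifts with
  -- literally the same height and target size.
  let D := fun n N hN hn => Classical.choice (hD n N hN hn)
  let O' : Outcome c Color Unit (List S) := fun N =>
    if hN : N ∈ (P.problem c).inputs then
      (O (D N.size N hN rfl).network).map (D N.size N hN rfl).decode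
    else PMF.pure fun _ => []
  have hO' : ∀ n N (hN : N ∈ (P.problem c).inputs) (hn : N.size = n),
      O' N = (O (D n N hN hn).network).map (D n N hN hn).decode := by
    rintro _ N hN rfl
    exact dif_pos hN
  refine ⟨O', fun G hG H hH hsize A B φ h0 hT => ?_, fun N hN => ?_⟩
  · rw [hO' _ G hG rfl, hO' _ H hH hsize.symm]
    set DG := D G.size G hG rfl
    set DH := D G.size H hH hsize.symm
    have hne : ∀ {N : Network c NodeKind HalfKind}, N.size = M G.size → Nonempty N.V := by
      intro N hN
      have := hM G.size
      exact Fintype.card_pos_iff.1 (by rw [Network.size] at hN; omega)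
    have : Nonempty DG.network.V := hne DG.size_network
    have : Nonempty DH.network.V := hne DH.size_network
    have key := hO DG.network (DG.network_mem hG hd) DH.network (DH.network_mem hH hd)
      (DG.size_network.trans DH.size_network.symm) (DG.roots A) (DH.roots B)
      (GadgetLift.liftMap DG DH φ)
      -- The case `T = 0`, where the required radius `3 * (0 / h)` is `0` again.
      (GadgetLift.viewIso_of_viewIso hsize h0 (by simpa using h0))
      (by rw [DG.size_network]; exact GadgetLift.viewIso_of_viewIso hsize h0 hT)
    have key := congrArg (PMF.map (DG.decodeRoots A)) key
    rw [PMF.map_comp, PMF.map_comp] at key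
    refine (PMF.map_comp _ _ _).trans (Eq.trans ?_ (PMF.map_comp _ _ _).symm)
    convert key using 2
    · funext y
      exact DG.decode_eq_decodeRoots A y
    · funext y
      exact DG.decode_comp_eq_decodeRoots DH h0 y
  · rw [hO' _ N hN rfl]
    set DN := D N.size N hN rfl
    have h1 := hsol DN.network (DN.network_mem hN hd)
    rw [DN.size_network] at h1
    have hle : N.size ≤ M N.size := by
      refine le_trans ?_ ((Nat.le_add_right _ _).trans (hM N.size))
      rcases Nat.eq_zero_or_pos N.size with h | h
      · omega
      · exact Nat.le_mul_of_pos_right _ (by unfold blockSize; positivity)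
    -- The lift is at least as large as `N`, so monotonicity gives `p (M n) ≤ p n`.
    refine le_trans ?_ (h1.trans (ENNReal.ofReal_le_ofReal (hp hle)))
    rw [PMF.toOuterMeasure_map_apply]
    exact MeasureTheory.measure_mono fun y hy hy' => hy (DN.decode_solution hN hy')

/-- Without black nodes, there are no edges. -/
theorem solvableNS_zero_of_sizes_eq_empty (hP : P.sizes = ∅) (p : ℕ → ℝ) :
    (P.problem c).SolvableNS p fun _ => 0 := by
  have hwhite : ∀ N ∈ (P.problem c).inputs, ∀ v, N.label v = .white := by
    intro N hN v
    cases h : N.label v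
    · rfl
    · have := hN.2 v h
      simp [hP] at this
  refine ⟨fun N => PMF.pure fun _ => [], fun G hG H hH hn A B φ h0 hT => ?_, fun N hN => ?_⟩
  · rw [PMF.pure_map, PMF.pure_map]
  · have : {y | ¬ (P.problem c).Solution N y} ∩ (PMF.pure fun _ : N.V => ([] : List S)).support
        = ∅ := by
      ext y
      simp only [PMF.support_pure, Set.mem_inter_iff, Set.mem_singleton_iff,
        Set.mem_empty_iff_false, iff_false]
      rintro ⟨hy, rfl⟩
      refine hy ⟨fun v _ => ⟨?_, by simp, by simp, by simp⟩, fun u hu => ?_⟩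
      · have : N.graph.neighborSet v = ∅ := by
          ext w
          simp only [SimpleGraph.mem_neighborSet, Set.mem_empty_iff_false, iff_false]
          exact fun h => hN.1 v w h ((hwhite N hN v).trans (hwhite N hN w).symm)
        simp [Network.degree, this]
      · simp [hwhite N hN u] at hu
    rw [← PMF.toOuterMeasure_apply_inter_support, this]
    simp

open Network in
/-- An outcome for the promise problem on instances with `M n ≥ n ^ 3` nodes yields one for the
linearizable problem that is faster by a factor of order `log n`. -/
theorem exists_solvableNS_of_promise (hc : 1 ≤ c) {p : ℕ → ℝ} (hp : Antitone p) {T : ℕ → ℕ}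
    (hs : (P.promise c).SolvableNS p T) {M : ℕ → ℕ} (hM : ∀ n, n ^ 3 ≤ M n) :
    ∃ T' : ℕ → ℕ, (P.problem c).SolvableNS p T' ∧
      ∀ᶠ n : ℕ in atTop, (T' n : ℝ) ≤ 6 * ((T (M n) : ℝ) / Real.log n) := by
  rcases P.sizes.eq_empty_or_nonempty with hP | ⟨d, hd⟩
  · refine ⟨_, solvableNS_zero_of_sizes_eq_empty hP p, ?_⟩
    filter_upwards [eventually_ge_atTop 1] with n hn
    have : 0 ≤ Real.log n := Real.log_natCast_nonneg n
    simp only [Nat.cast_zero]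
    positivity
  -- Chosen so that `4 * 2 ^ h ≤ n` for large `n`: then `n * n * (2 ^ h + 2)` plus the room for the
  -- padding stays below `n ^ 3`.
  let h : ℕ → ℕ := fun n => max 1 (Nat.log 2 n - 2)
  -- For the finitely many small `n` the given size may be too small for the lift, so it is replaced
  -- by one that suffices; the final bound is asymptotic only.
  let M' : ℕ → ℕ := fun n => if 24 * d + 16 ≤ n then M n else n * blockSize n (h n) + (6 * d + 3)
  have hlarge : ∀ n, 24 * d + 16 ≤ n → ∃ e, 2 ≤ e ∧ h n = e ∧ Nat.log 2 n = e + 2 := by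
    intro n hn
    have : 4 ≤ Nat.log 2 n := Nat.le_log_of_pow_le (by norm_num) (by omega)
    exact ⟨Nat.log 2 n - 2, by omega, by simp only [h]; omega, by omega⟩
  refine ⟨_, solvableNS_of_promise hc hd hp hs (M := M') (h := h) (fun n => by simp [h])
    fun n => ?_, ?_⟩
  · by_cases hn : 24 * d + 16 ≤ n
    · simp only [M', if_pos hn]
      refine le_trans ?_ (hM n)
      obtain ⟨e, he, hhe, hlog⟩ := hlarge n hn
      have h1 : 4 * 2 ^ e ≤ n := by
        have := Nat.pow_log_le_self 2 (show n ≠ 0 by omega)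
        rw [hlog, pow_add] at this
        omega
      rw [hhe, blockSize]
      have h2 : n * n * (4 * 2 ^ e) ≤ n * n * n := Nat.mul_le_mul_left _ h1
      have h3 : n * n * 16 ≤ n * n * n := Nat.mul_le_mul_left _ (by omega)
      have h4 : n * 1 ≤ n * n := Nat.mul_le_mul_left _ (by omega)
      nlinarith
    · simp only [M', if_neg hn, le_refl]
  · filter_upwards [eventually_ge_atTop (24 * d + 16)] with n hn
    obtain ⟨e, he, hhe, hlog⟩ := hlarge n hn
    simp only [M', if_pos hn, hhe]
    have hn1 : (1 : ℝ) < n := by exact_mod_cast (show 1 < n by omega)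
    have hlogpos : 0 < Real.log n := Real.log_pos hn1
    -- From `n < 2 ^ (e + 3)` and `log 2 < 0.7`; `e ≥ 2` gives `0.7 * (e + 3) ≤ 2 * e`. This turns
    -- the factor `3` into `6`.
    have hle : Real.log n ≤ 2 * e := by
      have h1 : n < 2 ^ (e + 3) := by
        have := Nat.lt_pow_succ_log_self (b := 2) (by norm_num) n
        rwa [hlog] at this
      have h2 : Real.log n ≤ (e + 3 : ℕ) * Real.log 2 := by
        rw [← Real.log_pow]
        exact Real.log_le_log (by linarith) (by exact_mod_cast h1.le)
      have h3 := Real.log_two_lt_d9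
      have h4 : (2 : ℝ) ≤ e := by exact_mod_cast he
      push_cast at h2
      nlinarith
    have he0 : (0 : ℝ) < e := by exact_mod_cast (show 0 < e by omega)
    calc ((3 * (T (M n) / e) : ℕ) : ℝ) ≤ 3 * ((T (M n) : ℝ) / e) := by
          push_cast
          gcongr
          exact Nat.cast_div_le
      _ ≤ 3 * ((T (M n) : ℝ) / (Real.log n / 2)) := by
          gcongr
          linarith
      _ = 6 * ((T (M n) : ℝ) / Real.log n) := by
          field_simp
          ring

end LinearizableProblem

/-! ### Cube roots and the two quantitative statements -/

theorem floor_rpow_third (n : ℕ) :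
    ⌊(n : ℝ) ^ (1 / 3 : ℝ)⌋₊ ^ 3 ≤ n ∧ n < (⌊(n : ℝ) ^ (1 / 3 : ℝ)⌋₊ + 1) ^ 3 := by
  have h0 : (0 : ℝ) ≤ (n : ℝ) ^ (1 / 3 : ℝ) := by positivity
  have h1 : ((n : ℝ) ^ (1 / 3 : ℝ)) ^ 3 = n := by
    rw [← Real.rpow_natCast, ← Real.rpow_mul (Nat.cast_nonneg n)]
    norm_num
  constructor
  · have := pow_le_pow_left₀ (Nat.cast_nonneg _) (Nat.floor_le h0) 3
    rw [h1] at this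
    exact_mod_cast this
  · have := pow_lt_pow_left₀ (Nat.lt_floor_add_one ((n : ℝ) ^ (1 / 3 : ℝ))) h0 (n := 3) (by norm_num)
    rw [h1] at this
    exact_mod_cast this

theorem mainTheorem5 {S : Type} [Fintype S] (P : LinearizableProblem S) (c : ℕ) (hc : 1 ≤ c) :
    -- turning outcomes for the promise problem, or for the lifted problem, into outcomes for `P`
    (∃ C : ℝ, 0 < C ∧ ∀ (p : ℕ → ℝ) (q : ℝ), Antitone p → (∀ n, p n ≤ q) → q < 1 →
      ∀ T : ℕ → ℕ, ((P.promise c).SolvableNS p T ∨ (P.lift c).SolvableNS p T) →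
        ∃ T' : ℕ → ℕ, (P.problem c).SolvableNS p T' ∧
          ∀ᶠ n : ℕ in atTop, (T' n : ℝ) ≤ C * ((T (n ^ 3) : ℝ) / Real.log n)) ∧
    -- the lower bound
    (∃ κ : ℝ, 0 < κ ∧ ∀ (p : ℕ → ℝ) (q : ℝ), Antitone p → (∀ n, p n ≤ q) → q < 1 →
      ∀ T : ℕ → ℝ,
        (∀ T' : ℕ → ℕ, (P.problem c).SolvableNS p T' → ∀ᶠ n : ℕ in atTop, T n ≤ T' n) →
        ∀ T' : ℕ → ℕ, ((P.promise c).SolvableNS p T' ∨ (P.lift c).SolvableNS p T') →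
          ∀ᶠ n : ℕ in atTop,
            κ * (T ⌊(n : ℝ) ^ (1 / 3 : ℝ)⌋₊ * Real.log n) ≤ T' n) := by
  have hpromise : ∀ {p : ℕ → ℝ} {T : ℕ → ℕ},
      ((P.promise c).SolvableNS p T ∨ (P.lift c).SolvableNS p T) → (P.promise c).SolvableNS p T :=
    fun h => h.elim id P.promise_solvableNS_of_lift
  refine ⟨⟨6, by norm_num, fun p q hp _ _ T hT =>
    LinearizableProblem.exists_solvableNS_of_promise hc hp (hpromise hT) fun n => le_rfl⟩,
    1 / 36, by norm_num, fun p q hp _ _ T hlow T' hT' => ?_⟩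
  -- `T'` need not be monotone, and the bound must hold at every `n`. Padding to a size that
  -- minimizes `T'` among all `n` with cube root `m` makes one reduction serve all of them.
  have hmin : ∀ m : ℕ, ∃ N, m ^ 3 ≤ N ∧ ∀ n, m ^ 3 ≤ n → n < (m + 1) ^ 3 → T' N ≤ T' n := by
    intro m
    obtain ⟨N, hN, hmin⟩ := Finset.exists_min_image (Finset.Ico (m ^ 3) ((m + 1) ^ 3)) T'
      ⟨m ^ 3, Finset.mem_Ico.2 ⟨le_rfl, Nat.pow_lt_pow_left (Nat.lt_succ_self m) (by norm_num)⟩⟩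
    exact ⟨N, (Finset.mem_Ico.1 hN).1, fun n h1 h2 => hmin n (Finset.mem_Ico.2 ⟨h1, h2⟩)⟩
  choose M hM hM' using hmin
  obtain ⟨T₁, hT₁, hle⟩ :=
    LinearizableProblem.exists_solvableNS_of_promise hc hp (hpromise hT') hM
  have hm : Tendsto (fun n : ℕ => ⌊(n : ℝ) ^ (1 / 3 : ℝ)⌋₊) atTop atTop :=
    tendsto_nat_floor_atTop.comp
      ((tendsto_rpow_atTop (by norm_num)).comp tendsto_natCast_atTop_atTop)
  filter_upwards [hm.eventually (((hlow T₁ hT₁).and hle).and (eventually_ge_atTop 2))]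
    with n ⟨⟨h1, h2⟩, hm2⟩
  obtain ⟨h3, h4⟩ := floor_rpow_third n
  generalize ⌊(n : ℝ) ^ (1 / 3 : ℝ)⌋₊ = m at *
  have hm2' : (2 : ℝ) ≤ m := by exact_mod_cast hm2
  have hlogm : 0 < Real.log m := Real.log_pos (by linarith)
  have hn1 : 1 ≤ n := le_trans (Nat.one_le_pow _ _ (by omega)) h3
  -- From `n < (m + 1) ^ 3 ≤ (m ^ 2) ^ 3`, as `m ≥ 2`. Together with the factor `6` of the reduction
  -- this gives `κ = 1 / 36`.
  have hlogn : Real.log n ≤ 6 * Real.log m := by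
    have h5 : (n : ℝ) ≤ ((m : ℝ) ^ 2) ^ 3 := by
      have : n ≤ (m ^ 2) ^ 3 := h4.le.trans (Nat.pow_le_pow_left (by nlinarith) 3)
      exact_mod_cast this
    have := Real.log_le_log (by exact_mod_cast hn1) h5
    rw [Real.log_pow, Real.log_pow] at this
    push_cast at this
    linarith
  have hlogn0 : 0 ≤ Real.log n := Real.log_natCast_nonneg n
  have h6 : (T' (M m) : ℝ) ≤ T' n := by exact_mod_cast hM' m n h3 h4
  calc 1 / 36 * (T m * Real.log n)
      ≤ 1 / 36 * (6 * ((T' n : ℝ) / Real.log m) * (6 * Real.log m)) := by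
        gcongr
        refine h1.trans (h2.trans ?_)
        gcongr
    _ = T' n := by
        field_simp
        norm_num
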